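/- Let $n\ge 0$, and regard elements of $\mathbb{R}^n$ as rows. For $v_+,v_-\in\mathbb{R}^n$ and $\alpha\in\mathbb{R}$ let $T(v_+,v_-,\alpha)$ be the unitary operator in $L^2(\mathbb{R}^n)$ $$T(v_+,v_-,\alpha)f(x)=f\bigl(x+\sqrt{2\pi}\,v_+\bigr)\exp\Bigl\{\sqrt{2\pi}\,i\,x v_-^t+2\pi i\bigl(\alpha+\tfrac12 v_+v_-^t\bigr)\Bigr\}$$ (the standard representation of the real Heisenberg group). For $g\in\mathrm{Sp}(2n,\mathbb{R})$, that is, a real $2n\times 2n$ matrix with $g\begin{pmatrix}0&1\\-1&0\end{pmatrix}g^t=\begin{pmatrix}0&1\\-1&0\end{pmatrix}$, let $\sigma(g)(v_+,v_-,\alpha)=(w_+,w_-,\alpha)$, where $w_+\oplus w_-=(v_+\oplus v_-)g$. An operator of the Weil representation corresponding to $g$ is a unitary operator $\mathrm{We}(g)$ in $L^2(\mathbb{R}^n)$ such that $$T(\sigma(g)h)=\mathrm{We}(g)^{-1}\,T(h)\,\mathrm{We}(g)\qquad\text{for all } h=(v_+,v_-,\alpha).$$ Let $\mathcal{S}'(\mathbb{R}^n)$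 be the space of tempered distributions with the topology of pointwise convergence on Schwartz functions; $L^2(\mathbb{R}^n)$ is embedded in it by $f\mapsto(\varphi\mapsto\int\varphi f)$. Let $\mathcal{P}(\mathbb{R}^n)\subset\mathcal{S}'(\mathbb{R}^n)$ be the complex linear span of the distributions $$\sum_{k_1,\dots,k_n\in\mathbb{Z}}\delta\Bigl(x-\sqrt{2\pi}\bigl(b+\sum_j k_ja_j\bigr)\Bigr),$$ where $a_1,\dots,a_n\in\mathbb{Q}^n$ are linearly independent over $\mathbb{Q}$ and $b\in\mathbb{Q}^n$. **Theorem.** The space $\mathcal{P}(\mathbb{R}^n)$ is invariant with respect to the action of the group $\mathrm{Sp}(2n,\mathbb{Q})$ by the operators of the Weil representation. That is, for every $g\in\mathrm{Sp}(2n,\mathbb{Q})\subset\mathrm{Sp}(2n,\mathbb{R})$ an operator $\mathrm{We}(g)$ exists, and every such operator has a unique continuous linear extension to $\mathcal{S}'(\mathbb{R}^n)$, and this extension maps $\mathcal{P}(\mathbb{R}^n)$ onto itself. -/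

import Mathlib

open MeasureTheory Matrix SchwartzMap
open scoped Matrix SchwartzMap

noncomputable section

/-- The Euclidean space `ℝⁿ`; its elements are regarded as rows. -/
abbrev Rn (n : ℕ) : Type := EuclideanSpace ℝ (Fin n)

/-- The Hilbert space `L²(ℝⁿ)` of complex-valued functions, with Lebesgue measure. -/
abbrev L2Rn (n : ℕ) : Type := Lp ℂ 2 (volume : Measure (Rn n))

/-- Coordinates `(v₊, v₋, α)` on the real Heisenberg group: this triple stands for the
`(1 + n + 1) × (1 + n + 1)` matrix with rows `(1, v₊, α + v₊ v₋ᵗ / 2)`, `(0, 1, v₋ᵗ)`, `(0, 0, 1)`.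
Thus `(v₊, v₋, α) (w₊, w₋, β) = (v₊ + w₊, v₋ + w₋, α + β + (v₊ w₋ᵗ - w₊ v₋ᵗ) / 2)`. -/
structure RealHeis (n : ℕ) where
  /-- the row `v₊` -/
  vPlus : Fin n → ℝ
  /-- the row `v₋` -/
  vMinus : Fin n → ℝ
  /-- the central coordinate -/
  alpha : ℝ

/-- The automorphism `σ(g)` of the Heisenberg group given by a symplectic matrix `g`: the row
`v₊ ⊕ v₋` is multiplied by `g` on the right, and `α` is kept. -/
def heisAut {n : ℕ} (g : symplecticGroup (Fin n) ℝ) (h : RealHeis n) : RealHeis n where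
  vPlus i := (Sum.elim h.vPlus h.vMinus ᵥ* (g : Matrix (Fin n ⊕ Fin n) (Fin n ⊕ Fin n) ℝ))
    (Sum.inl i)
  vMinus i := (Sum.elim h.vPlus h.vMinus ᵥ* (g : Matrix (Fin n ⊕ Fin n) (Fin n ⊕ Fin n) ℝ))
    (Sum.inr i)
  alpha := h.alpha

/-- The unimodular factor `exp {√(2π) i x v₋ᵗ + 2πi (α + v₊ v₋ᵗ / 2)}`. -/
def heisPhase {n : ℕ} (h : RealHeis n) (x : Rn n) : ℂ :=
  Complex.exp (((√(2 * Real.pi) * (⇑x ⬝ᵥ h.vMinus) +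
    2 * Real.pi * (h.alpha + (h.vPlus ⬝ᵥ h.vMinus) / 2) : ℝ) : ℂ) * Complex.I)

/-- The function
`x ↦ f (x + √(2π) v₊) exp {√(2π) i x v₋ᵗ + 2πi (α + v₊ v₋ᵗ / 2)}`. -/
def heisFun {n : ℕ} (h : RealHeis n) (f : Rn n → ℂ) (x : Rn n) : ℂ :=
  f (x + √(2 * Real.pi) • WithLp.toLp 2 h.vPlus) * heisPhase h x

theorem memLp_heisFun {n : ℕ} (h : RealHeis n) (f : L2Rn n) :
    MemLp (heisFun h f) 2 (volume : Measure (Rn n)) := by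
  have h1 : MemLp (fun x : Rn n => f (x + √(2 * Real.pi) • WithLp.toLp 2 h.vPlus)) 2 volume :=
    (Lp.memLp f).comp_measurePreserving (measurePreserving_add_right volume _)
  have hc : Continuous (heisPhase h) := by
    unfold heisPhase dotProduct
    fun_prop
  refine h1.congr_norm (h1.1.mul hc.aestronglyMeasurable) (Filter.Eventually.of_forall fun x => ?_)
  simp only [heisFun, heisPhase, norm_mul, Complex.norm_exp_ofReal_mul_I, mul_one]

/-- The standard representation `T` of the real Heisenberg group in `L²(ℝⁿ)`. -/
def heisRep {n : ℕ} (h : RealHeis n) (f : L2Rn n) : L2Rn n :=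
  (memLp_heisFun h f).toLp (heisFun h f)

/-- `U` is an operator `We(g)` of the Weil representation: a unitary operator in `L²(ℝⁿ)` with
`T(σ(g) h) = We(g)⁻¹ T(h) We(g)` for every `h` in the real Heisenberg group. -/
def IsWeilOperator {n : ℕ} (g : symplecticGroup (Fin n) ℝ) (U : L2Rn n ≃ₗᵢ[ℂ] L2Rn n) : Prop :=
  ∀ (h : RealHeis n) (f : L2Rn n), heisRep (heisAut g h) f = U.symm (heisRep h (U f))

/-- `W` extends the operator `U` of `L²(ℝⁿ)` to the space of tempered distributions, in which
`L²(ℝⁿ)` is embedded by `f ↦ (φ ↦ ∫ φ f)`. -/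
def ExtendsToTempered {n : ℕ} (U : L2Rn n ≃ₗᵢ[ℂ] L2Rn n)
    (W : 𝓢'(Rn n, ℂ) →L[ℂ] 𝓢'(Rn n, ℂ)) : Prop :=
  ∀ f : L2Rn n, W (Lp.toTemperedDistribution f) = Lp.toTemperedDistribution (U f)

/-- The point `√(2π) (b + ∑ⱼ kⱼ aⱼ)` of `ℝⁿ`. -/
def latticePoint {n : ℕ} (a : Fin n → Fin n → ℚ) (b : Fin n → ℚ) (k : Fin n → ℤ) : Rn n :=
  √(2 * Real.pi) • WithLp.toLp 2 (fun i => ((b i + ∑ j, (k j : ℚ) * a j i : ℚ) : ℝ))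

/-- The space `𝒫(ℝⁿ)` of Poisson distributions: the complex span of the tempered distributions
`∑_{k ∈ ℤⁿ} δ(x - √(2π) (b + ∑ⱼ kⱼ aⱼ))`, where `a₁, …, aₙ ∈ ℚⁿ` are linearly independent and
`b ∈ ℚⁿ`. The sum converges unconditionally in the topology of `𝓢'`. -/
def poissonSpace (n : ℕ) : Submodule ℂ 𝓢'(Rn n, ℂ) :=
  Submodule.span ℂ {χ | ∃ (a : Fin n → Fin n → ℚ) (b : Fin n → ℚ), LinearIndependent ℚ a ∧
    HasSum (fun k : Fin n → ℤ => TemperedDistribution.delta (latticePoint a b k)) χ}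

/-- The embedding `Sp(2n, ℚ) → Sp(2n, ℝ)`. -/
def ratToRealSp {n : ℕ} (g : symplecticGroup (Fin n) ℚ) : symplecticGroup (Fin n) ℝ :=
  ⟨(g : Matrix (Fin n ⊕ Fin n) (Fin n ⊕ Fin n) ℚ).map (Rat.castHom ℝ),
    SymplecticGroup.map_mem g.2 (Rat.castHom ℝ)⟩

end

/-!
The rational symplectic group is generated by three kinds of matrices, `(1 S; 0 1)` with `S`
symmetric, `(A 0; 0 A⁻ᵀ)` and `J`. The last step of the reduction is that `A + t C` is invertible
for some rational `t` when `(A B; C D)` is symplectic: its determinant is a polynomial in `t` which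
does not vanish at `t = i` (`symplecticGroup_submonoid_eq_top`).

For each generator an operator of the Weil representation is written down on Schwartz functions:
multiplication by the chirp `exp (i x S xᵗ / 2)`, the change of variables `|det A|^{1/2} φ(x A)`,
and the Fourier transform `(2π)^{-n/2} ∫ exp (-i x yᵗ) φ(y) dy`. Each of them is isometric for the
`L²` norm and has a transpose on Schwartz functions, so it extends to `L²` by density and to `𝓢'`
by duality (`exists_isWeilOperator_of_schwartz`). It remains to see what they do to a lattice sum
of delta functions. A change of variables gives another such sum. A chirp multiplies the
coefficients by `exp (π i q(k))` with a rational quadratic polynomial `q`; this is periodic in `k`,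
so the result is a finite combination of sums over cosets of a sublattice
(`mem_poissonSpace_of_ratQuad`). The Fourier transform is treated by Poisson summation, which gives
the sum over the dual lattice with coefficients `exp (2π i m zᵗ)`, `z` rational; these are again
periodic in `m`. Poisson summation in several variables is proved from the Fourier series on the
torus (`SchwartzMap.hasSum_poisson`).

An arbitrary operator `We(g)` differs from the one constructed by a nonzero scalar, by Schur's lemma
(`exists_smul_of_isWeilOperator_one`): an operator commuting with all modulations is a
multiplication, and if it commutes with all translations too, the multiplier is constant. The
extension to `𝓢'` is unique because every continuous functional on `𝓢'` is the evaluation at a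
Schwartz function (`ExtendsToTempered.unique`). Finally, the operators for `g` and `g⁻¹` both map
`𝒫` into itself and their product is a nonzero scalar, so the image of `𝒫` is all of `𝒫`.
-/

/-! ### Generators of the rational symplectic group -/

/-- The symplectic matrix `(1 S; 0 1)` with `S` symmetric. -/
def spUpper {l R : Type*} [DecidableEq l] [Fintype l] [CommRing R] (S : Matrix l l R)
    (hS : S.IsSymm) : symplecticGroup l R :=
  ⟨fromBlocks 1 S 0 1, SymplecticGroup.fromBlocks_mem_iff.2 (by simp [hS.eq])⟩

/-- The symplectic matrix `(A 0; 0 A⁻ᵀ)`; the inverse of `A` is passed as the argument `A'`. -/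
def spDiag {l R : Type*} [DecidableEq l] [Fintype l] [CommRing R] (A A' : Matrix l l R)
    (h : A' * A = 1) : symplecticGroup l R :=
  ⟨fromBlocks A 0 0 A'ᵀ, SymplecticGroup.fromBlocks_mem_iff.2
    (by simp [← Matrix.transpose_mul, h])⟩

/-- The determinant of `A + t C` is a polynomial in `t` which does not vanish at `t = i`, because
`(A - i C)ᵀ (A + i C) = Aᵀ A + Cᵀ C` is positive definite. Hence it does not vanish at some
rational `t`. -/
theorem exists_det_add_smul_ne_zero {l : Type*} [DecidableEq l] [Fintype l]
    {A B C D : Matrix l l ℚ} (h : fromBlocks A B C D ∈ symplecticGroup l ℚ) :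
    ∃ t : ℚ, (A + t • C).det ≠ 0 := by
  obtain ⟨hAC, -, hAD⟩ := SymplecticGroup.fromBlocks_mem_iff.1 h
  have hpos : (Aᵀ * A + Cᵀ * C).det ≠ 0 := by
    intro h0
    obtain ⟨v, hv, hv0⟩ := Matrix.exists_mulVec_eq_zero_iff.2 h0
    have h1 : (A *ᵥ v) ⬝ᵥ (A *ᵥ v) + (C *ᵥ v) ⬝ᵥ (C *ᵥ v) = 0 := by
      have := congrArg (fun w => v ⬝ᵥ w) hv0
      simpa [Matrix.add_mulVec, dotProduct_add, ← Matrix.mulVec_mulVec, Matrix.dotProduct_mulVec,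
        Matrix.vecMul_transpose] using this
    have hA : 0 ≤ (A *ᵥ v) ⬝ᵥ (A *ᵥ v) := Finset.sum_nonneg fun i _ => mul_self_nonneg _
    have hC : 0 ≤ (C *ᵥ v) ⬝ᵥ (C *ᵥ v) := Finset.sum_nonneg fun i _ => mul_self_nonneg _
    have hA0 : A *ᵥ v = 0 := dotProduct_self_eq_zero.1 (by linarith)
    have hC0 : C *ᵥ v = 0 := dotProduct_self_eq_zero.1 (by linarith)
    have h2 : Dᵀ * A - Bᵀ * C = 1 := by
      simpa [Matrix.transpose_sub, Matrix.transpose_mul] using congrArg Matrix.transpose hAD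
    have h3 := congrArg (· *ᵥ v) h2
    simp only [Matrix.sub_mulVec, ← Matrix.mulVec_mulVec, hA0, hC0, Matrix.mulVec_zero, sub_zero,
      Matrix.one_mulVec] at h3
    exact hv h3.symm
  by_contra! hcon
  let p : Polynomial ℚ :=
    (A.map Polynomial.C + (Polynomial.X : Polynomial ℚ) • C.map Polynomial.C).det
  have hp : p = 0 := by
    refine Polynomial.funext fun t => ?_
    rw [Polynomial.eval_zero, ← hcon t, ← Polynomial.coe_evalRingHom, RingHom.map_det]
    congr 1
    ext i j
    simp [smul_eq_mul]
    exact mul_comm _ _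
  have hI : (A.map (algebraMap ℚ ℂ) + Complex.I • C.map (algebraMap ℚ ℂ)).det = 0 := by
    have := congrArg (Polynomial.aeval Complex.I) hp
    rw [map_zero, ← AlgHom.coe_toRingHom, RingHom.map_det] at this
    rw [← this]
    congr 1
    ext i j
    simp [smul_eq_mul]
    exact mul_comm _ _
  have hprod : (A.map (algebraMap ℚ ℂ) - Complex.I • C.map (algebraMap ℚ ℂ))ᵀ *
      (A.map (algebraMap ℚ ℂ) + Complex.I • C.map (algebraMap ℚ ℂ)) =
      (Aᵀ * A + Cᵀ * C).map (algebraMap ℚ ℂ) := by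
    have hAC' := congrArg (fun M => M.map (algebraMap ℚ ℂ)) hAC
    simp only [Matrix.map_mul, Matrix.transpose_map] at hAC'
    rw [Matrix.map_add _ (map_add _), Matrix.map_mul, Matrix.map_mul, Matrix.transpose_map,
      Matrix.transpose_map, Matrix.transpose_sub, Matrix.transpose_smul, Matrix.sub_mul,
      Matrix.mul_add, Matrix.mul_add, Matrix.mul_smul, Matrix.smul_mul, Matrix.smul_mul,
      Matrix.mul_smul, smul_smul, Complex.I_mul_I, hAC', neg_one_smul]
    abel
  have h4 := congrArg Matrix.det hprod
  rw [Matrix.det_mul, hI, mul_zero, ← RingHom.mapMatrix_apply, ← RingHom.map_det] at h4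
  exact hpos ((map_eq_zero _).1 h4.symm)

/-- The rational symplectic group is generated, as a monoid, by the matrices `(1 S; 0 1)`,
`(A 0; 0 A⁻ᵀ)` and `J`. -/
theorem symplecticGroup_submonoid_eq_top {l : Type*} [DecidableEq l] [Fintype l]
    (K : Submonoid (symplecticGroup l ℚ)) (hJ : SymplecticGroup.symJ l ℚ ∈ K)
    (hU : ∀ S hS, spUpper S hS ∈ K) (hD : ∀ A A' h, spDiag A A' h ∈ K) : K = ⊤ := by
  have hL : ∀ S : Matrix l l ℚ, S.IsSymm → ∀ h,
      (⟨fromBlocks 1 0 S 1, h⟩ : symplecticGroup l ℚ) ∈ K := by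
    intro S hS h
    have hS' : (-S).IsSymm := by simpa [Matrix.IsSymm] using hS
    have := K.mul_mem (K.mul_mem hJ (hU (-S) hS')) (K.mul_mem hJ (K.mul_mem hJ hJ))
    convert this using 1
    apply Subtype.ext
    simp [spUpper, SymplecticGroup.symJ, Matrix.J, fromBlocks_multiply]
  have hinv : ∀ A B C D : Matrix l l ℚ, ∀ h, A.det ≠ 0 →
      (⟨fromBlocks A B C D, h⟩ : symplecticGroup l ℚ) ∈ K := by
    intro A B C D h hA
    obtain ⟨hAC, hBD, hAD⟩ := SymplecticGroup.fromBlocks_mem_iff.1 h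
    have hu : IsUnit A.det := isUnit_iff_ne_zero.2 hA
    have hAi : A * A⁻¹ = 1 := Matrix.mul_nonsing_inv A hu
    have hiA : A⁻¹ * A = 1 := Matrix.nonsing_inv_mul A hu
    have hAit : A⁻¹ᵀ * Aᵀ = 1 := by rw [← Matrix.transpose_mul, hAi, Matrix.transpose_one]
    have hiAt : Aᵀ * A⁻¹ᵀ = 1 := by rw [← Matrix.transpose_mul, hiA, Matrix.transpose_one]
    have hS1 : (C * A⁻¹).IsSymm := by
      unfold Matrix.IsSymm
      calc (C * A⁻¹)ᵀ = A⁻¹ᵀ * (Cᵀ * A) * A⁻¹ := by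
            rw [Matrix.transpose_mul, Matrix.mul_assoc, Matrix.mul_assoc, hAi, Matrix.mul_one]
        _ = C * A⁻¹ := by rw [← hAC, ← Matrix.mul_assoc, hAit, Matrix.one_mul]
    -- `D = A⁻ᵀ + C A⁻¹ B`
    have hD' : D = A⁻¹ᵀ + C * A⁻¹ * B := by
      have : D = A⁻¹ᵀ * (Aᵀ * D - Cᵀ * B) + A⁻¹ᵀ * Cᵀ * B := by
        rw [Matrix.mul_sub, ← Matrix.mul_assoc, hAit, Matrix.one_mul, Matrix.mul_assoc]
        abel
      rw [hAD, Matrix.mul_one, ← Matrix.transpose_mul, hS1.eq] at this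
      exact this
    have hS2 : (A⁻¹ * B).IsSymm := by
      have h1 : Bᵀ * A⁻¹ᵀ = A⁻¹ * B := by
        have h2 := hBD
        rw [hD', Matrix.transpose_add, Matrix.transpose_mul, hS1.eq, Matrix.mul_add,
          Matrix.add_mul, Matrix.transpose_transpose, ← Matrix.mul_assoc] at h2
        exact add_right_cancel h2
      unfold Matrix.IsSymm
      rw [Matrix.transpose_mul, h1]
    have hmem : (fromBlocks 1 0 (C * A⁻¹) 1 : Matrix (l ⊕ l) (l ⊕ l) ℚ) ∈ symplecticGroup l ℚ :=
      SymplecticGroup.fromBlocks_mem_iff.2 (by simp [hS1.eq])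
    convert K.mul_mem (K.mul_mem (hL _ hS1 hmem) (hD A A⁻¹ hiA)) (hU _ hS2) using 1
    apply Subtype.ext
    simp only [spUpper, spDiag, Submonoid.coe_mul, fromBlocks_multiply, Matrix.one_mul,
      Matrix.mul_one, Matrix.mul_zero, Matrix.zero_mul, add_zero, zero_add]
    rw [Matrix.mul_assoc C, hiA, Matrix.mul_one, ← Matrix.mul_assoc A, hAi, Matrix.one_mul,
      ← Matrix.mul_assoc C, hD', add_comm]
  refine eq_top_iff.2 fun g _ => ?_
  obtain ⟨M, hM⟩ := g
  obtain ⟨A, B, C, D, rfl⟩ : ∃ A B C D : Matrix l l ℚ, M = fromBlocks A B C D :=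
    ⟨_, _, _, _, (fromBlocks_toBlocks M).symm⟩
  obtain ⟨t, ht⟩ := exists_det_add_smul_ne_zero hM
  have hs : ∀ s : ℚ, (s • (1 : Matrix l l ℚ)).IsSymm := fun s => by simp [Matrix.IsSymm]
  have h2 := (spUpper (t • 1) (hs t) * ⟨_, hM⟩ : symplecticGroup l ℚ).2
  have h1 : (spUpper (t • 1) (hs t) * ⟨_, hM⟩ : symplecticGroup l ℚ) ∈ K := by
    have e : (spUpper (t • 1) (hs t) * ⟨_, hM⟩ : symplecticGroup l ℚ) =
        (⟨fromBlocks (A + t • C) (B + t • D) C D, by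
          convert h2 using 1; simp [spUpper, fromBlocks_multiply]⟩ : symplecticGroup l ℚ) := by
      apply Subtype.ext; simp [spUpper, fromBlocks_multiply]
    rw [e]
    exact hinv _ _ _ _ _ ht
  have h3 := K.mul_mem (hU ((-t) • 1) (hs _)) h1
  convert h3 using 1
  apply Subtype.ext
  simp [spUpper, fromBlocks_multiply, add_assoc, neg_smul]

/-! ### Continuous functionals on tempered distributions -/

/-- The dual of `𝓢'` with the topology of pointwise convergence is `𝓢`. -/
theorem TemperedDistribution.exists_eq_eval {n : ℕ} (Λ : 𝓢'(Rn n, ℂ) →L[ℂ] ℂ) :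
    ∃ ψ : 𝓢(Rn n, ℂ), ∀ χ : 𝓢'(Rn n, ℂ), Λ χ = χ ψ := by
  let e := PointwiseConvergenceCLM.equivWeakDual ℂ 𝓢(Rn n, ℂ)
  obtain ⟨ψ, hψ⟩ := LinearMap.dualEmbedding_surjective
    (topDualPairing ℂ 𝓢(Rn n, ℂ)) (Λ.comp (e.symm : WeakDual ℂ 𝓢(Rn n, ℂ) →L[ℂ] 𝓢'(Rn n, ℂ)))
  refine ⟨ψ, fun χ => ?_⟩
  have := congrArg (fun F => F (e χ)) hψ
  exact this.symm

theorem SchwartzMap.eq_zero_of_integral_mul_Lp {n : ℕ} (ψ : 𝓢(Rn n, ℂ))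
    (h : ∀ f : L2Rn n, ∫ x, ψ x • f x = 0) : ψ = 0 := by
  have hm : MemLp (fun x => star (ψ x)) 2 (volume : Measure (Rn n)) := (ψ.memLp 2).star
  have h1 := h (hm.toLp _)
  have h2 : ∫ x, ‖ψ x‖ ^ 2 = 0 := by
    have : ∫ x, ψ x • (hm.toLp _) x = ∫ x, ((‖ψ x‖ ^ 2 : ℝ) : ℂ) := by
      refine integral_congr_ae ?_
      filter_upwards [hm.coeFn_toLp] with x hx
      rw [hx, smul_eq_mul]
      simpa using Complex.mul_conj' (ψ x)
    rw [this, integral_complex_ofReal] at h1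
    exact_mod_cast h1
  have h3 : (fun x => ‖ψ x‖ ^ 2) = 0 := by
    refine Continuous.ae_eq_iff_eq (μ := (volume : Measure (Rn n))) (by fun_prop)
      (by fun_prop) |>.1 ?_
    refine (integral_eq_zero_iff_of_nonneg (fun x => by positivity) ?_).1 h2
    exact (memLp_two_iff_integrable_sq_norm (ψ.memLp 2).1).1 (ψ.memLp 2)
  ext x
  simpa using congrFun h3 x

/-- A continuous operator on `𝓢'` is determined by its values on `L²`. -/
theorem ExtendsToTempered.unique {n : ℕ} {U : L2Rn n ≃ₗᵢ[ℂ] L2Rn n}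
    {W W' : 𝓢'(Rn n, ℂ) →L[ℂ] 𝓢'(Rn n, ℂ)} (hW : ExtendsToTempered U W)
    (hW' : ExtendsToTempered U W') : W' = W := by
  ext χ φ
  let ev := PointwiseConvergenceCLM.evalCLM (RingHom.id ℂ) ℂ φ
  obtain ⟨ψ, hψ⟩ := TemperedDistribution.exists_eq_eval ((ev.comp W') - (ev.comp W))
  have h0 : ψ = 0 := by
    refine ψ.eq_zero_of_integral_mul_Lp fun f => ?_
    rw [← Lp.toTemperedDistribution_apply, ← hψ]
    simp [ev, hW f, hW' f]
  have := hψ χ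
  rw [h0, map_zero] at this
  exact sub_eq_zero.1 this

theorem ExtendsToTempered.mul {n : ℕ} {U V : L2Rn n ≃ₗᵢ[ℂ] L2Rn n}
    {W X : 𝓢'(Rn n, ℂ) →L[ℂ] 𝓢'(Rn n, ℂ)} (hW : ExtendsToTempered U W)
    (hX : ExtendsToTempered V X) : ExtendsToTempered (V.trans U) (W.comp X) := fun f => by
  simp [hX f, hW (V f)]

theorem ExtendsToTempered.of_smul {n : ℕ} {U V : L2Rn n ≃ₗᵢ[ℂ] L2Rn n} {c : ℂ}
    {W : 𝓢'(Rn n, ℂ) →L[ℂ] 𝓢'(Rn n, ℂ)} (hW : ExtendsToTempered U W)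
    (h : ∀ f, V f = c • U f) : ExtendsToTempered V (c • W) := fun f => by
  have := (Lp.toTemperedDistributionCLM ℂ (volume : Measure (Rn n)) 2).map_smul c (U f)
  simp only [Lp.toTemperedDistributionCLM_apply] at this
  rw [h f, this, _root_.smul_apply, hW f]

/-! ### Algebra of Weil operators -/

theorem isWeilOperator_iff {n : ℕ} {g : symplecticGroup (Fin n) ℝ} {U : L2Rn n ≃ₗᵢ[ℂ] L2Rn n} :
    IsWeilOperator g U ↔ ∀ h f, U (heisRep (heisAut g h) f) = heisRep h (U f) := by
  simp only [IsWeilOperator, LinearIsometryEquiv.eq_symm_apply]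

theorem heisAut_mul {n : ℕ} (g g' : symplecticGroup (Fin n) ℝ) (h : RealHeis n) :
    heisAut (g * g') h = heisAut g' (heisAut g h) := by
  have : (Sum.elim (heisAut g h).vPlus (heisAut g h).vMinus) =
      Sum.elim h.vPlus h.vMinus ᵥ* (g : Matrix (Fin n ⊕ Fin n) (Fin n ⊕ Fin n) ℝ) := by
    ext (i | i) <;> rfl
  simp only [heisAut] at this ⊢
  simp only [this, Submonoid.coe_mul, Matrix.vecMul_vecMul]

theorem heisAut_one {n : ℕ} (h : RealHeis n) : heisAut 1 h = h := by
  simp [heisAut]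

theorem IsWeilOperator.mul {n : ℕ} {g g' : symplecticGroup (Fin n) ℝ}
    {U U' : L2Rn n ≃ₗᵢ[ℂ] L2Rn n} (hU : IsWeilOperator g U) (hU' : IsWeilOperator g' U') :
    IsWeilOperator (g * g') (U'.trans U) := by
  rw [isWeilOperator_iff] at *
  intro h f
  simp [heisAut_mul, hU', hU]

theorem IsWeilOperator.one {n : ℕ} :
    IsWeilOperator (1 : symplecticGroup (Fin n) ℝ) (LinearIsometryEquiv.refl ℂ (L2Rn n)) := by
  rw [isWeilOperator_iff]
  intro h f
  simp [heisAut_one]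

theorem IsWeilOperator.symm {n : ℕ} {g : symplecticGroup (Fin n) ℝ}
    {U : L2Rn n ≃ₗᵢ[ℂ] L2Rn n} (hU : IsWeilOperator g U) : IsWeilOperator g⁻¹ U.symm := by
  rw [isWeilOperator_iff] at *
  intro h f
  have := hU (heisAut g⁻¹ h) (U.symm f)
  rw [← heisAut_mul, inv_mul_cancel, heisAut_one, U.apply_symm_apply] at this
  rw [← this, U.symm_apply_apply]

/-! ### Continuity of the Heisenberg operators and their action on Schwartz functions -/

theorem norm_heisPhase {n : ℕ} (h : RealHeis n) (x : Rn n) : ‖heisPhase h x‖ = 1 := by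
  rw [heisPhase, Complex.norm_exp_ofReal_mul_I]

theorem coeFn_heisRep {n : ℕ} (h : RealHeis n) (f : L2Rn n) :
    heisRep h f =ᵐ[volume] heisFun h f := (memLp_heisFun h f).coeFn_toLp

theorem heisFun_congr_ae {n : ℕ} (h : RealHeis n) {f g : Rn n → ℂ} (hfg : f =ᵐ[volume] g) :
    heisFun h f =ᵐ[volume] heisFun h g := by
  have := (measurePreserving_add_right (volume : Measure (Rn n))
    (√(2 * Real.pi) • WithLp.toLp 2 h.vPlus)).quasiMeasurePreserving.ae_eq hfg
  filter_upwards [this] with x hx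
  simp only [Function.comp_apply] at hx
  simp only [heisFun, hx]

theorem isometry_heisRep {n : ℕ} (h : RealHeis n) : Isometry (heisRep h) := by
  intro f g
  rw [heisRep, heisRep, Lp.edist_toLp_toLp, Lp.edist_def]
  have hτ := measurePreserving_add_right (volume : Measure (Rn n))
    (√(2 * Real.pi) • WithLp.toLp 2 h.vPlus)
  rw [← eLpNorm_comp_measurePreserving
    ((Lp.aestronglyMeasurable f).sub (Lp.aestronglyMeasurable g)) hτ]
  refine eLpNorm_congr_norm_ae (Filter.Eventually.of_forall fun x => ?_)
  simp [heisFun, ← sub_mul, norm_heisPhase]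

theorem hasTemperateGrowth_cexp_ofReal_mul_I :
    Function.HasTemperateGrowth (fun t : ℝ => Complex.exp (t * Complex.I)) := by
  have hd : ∀ k : ℕ, iteratedDeriv k (fun t : ℝ => Complex.exp (t * Complex.I)) =
      fun t : ℝ => Complex.I ^ k * Complex.exp (t * Complex.I) := by
    intro k
    induction k with
    | zero => simp
    | succ k ih =>
      rw [iteratedDeriv_succ, ih]
      funext t
      have h1 : HasDerivAt (fun t : ℝ => Complex.exp (t * Complex.I))
          (Complex.exp (t * Complex.I) * (1 * Complex.I)) t :=
        ((Complex.ofRealCLM.hasDerivAt (x := t)).mul_const Complex.I).cexp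
      rw [(h1.const_mul (Complex.I ^ k)).deriv]
      ring
  refine ⟨?_, fun k => ⟨0, 1, fun t => ?_⟩⟩
  · exact (Complex.ofRealCLM.contDiff.mul contDiff_const).cexp
  · rw [norm_iteratedFDeriv_eq_norm_iteratedDeriv, hd]
    simp [Complex.norm_exp_ofReal_mul_I]

theorem Function.HasTemperateGrowth.cexp_mul_I {n : ℕ} {q : Rn n → ℝ}
    (hq : q.HasTemperateGrowth) :
    Function.HasTemperateGrowth (fun x => Complex.exp (q x * Complex.I)) :=
  hasTemperateGrowth_cexp_ofReal_mul_I.comp hq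

theorem hasTemperateGrowth_dotProduct {n : ℕ} (v : Fin n → ℝ) :
    Function.HasTemperateGrowth (fun x : Rn n => ⇑x ⬝ᵥ v) := by
  have : (fun x : Rn n => ⇑x ⬝ᵥ v) = fun x : Rn n => inner ℝ (WithLp.toLp 2 v) x := by
    funext x
    simp [PiLp.inner_apply, dotProduct]
  rw [this]
  exact (innerSL ℝ (WithLp.toLp 2 v : Rn n)).hasTemperateGrowth

theorem hasTemperateGrowth_heisPhase {n : ℕ} (h : RealHeis n) :
    (heisPhase h).HasTemperateGrowth := by
  refine Function.HasTemperateGrowth.cexp_mul_I (q := fun x : Rn n =>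
    √(2 * Real.pi) * (⇑x ⬝ᵥ h.vMinus) + 2 * Real.pi * (h.alpha + (h.vPlus ⬝ᵥ h.vMinus) / 2)) ?_
  exact ((Function.HasTemperateGrowth.const _).mul (hasTemperateGrowth_dotProduct _)).add
    (Function.HasTemperateGrowth.const _)

/-- The operator `T(h)` on Schwartz functions. -/
noncomputable def heisSchwartz {n : ℕ} (h : RealHeis n) : 𝓢(Rn n, ℂ) →L[ℂ] 𝓢(Rn n, ℂ) :=
  (smulLeftCLM ℂ (heisPhase h)).comp
    (compSubConstCLM ℂ (-(√(2 * Real.pi) • WithLp.toLp 2 h.vPlus)))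

theorem heisSchwartz_apply {n : ℕ} (h : RealHeis n) (φ : 𝓢(Rn n, ℂ)) (x : Rn n) :
    heisSchwartz h φ x = heisFun h φ x := by
  simp [heisSchwartz, smulLeftCLM_apply_apply (hasTemperateGrowth_heisPhase h), heisFun, mul_comm]

theorem heisRep_toLp {n : ℕ} (h : RealHeis n) (φ : 𝓢(Rn n, ℂ)) :
    heisRep h (φ.toLp 2) = (heisSchwartz h φ).toLp 2 := by
  refine Lp.ext ?_
  refine (coeFn_heisRep h _).trans ((heisFun_congr_ae h (φ.coeFn_toLp 2)).trans ?_)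
  filter_upwards [(heisSchwartz h φ).coeFn_toLp 2 (volume : Measure (Rn n))] with x hx
  rw [hx, heisSchwartz_apply]

theorem toTemperedDistribution_toLp_apply {n : ℕ} (φ ψ : 𝓢(Rn n, ℂ)) :
    Lp.toTemperedDistribution (φ.toLp 2 (volume : Measure (Rn n))) ψ = ∫ x, ψ x * φ x := by
  rw [Lp.toTemperedDistribution_apply]
  refine integral_congr_ae ?_
  filter_upwards [φ.coeFn_toLp 2 (volume : Measure (Rn n))] with x hx
  rw [hx, smul_eq_mul]

/-- A bijection `B` of the Schwartz space which is isometric for the `L²` norm and intertwines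
the operators `T(h)` extends to an operator of the Weil representation. If `B` has a transpose
`Bt`, then this operator extends to `𝓢'` by `χ ↦ χ ∘ Bt`. -/
theorem exists_isWeilOperator_of_schwartz {n : ℕ} {g : symplecticGroup (Fin n) ℝ}
    (B : 𝓢(Rn n, ℂ) ≃ₗ[ℂ] 𝓢(Rn n, ℂ)) (Bt : 𝓢(Rn n, ℂ) →L[ℂ] 𝓢(Rn n, ℂ))
    (hn : ∀ φ, ‖(B φ).toLp 2 (volume : Measure (Rn n))‖ = ‖φ.toLp 2 (volume : Measure (Rn n))‖)
    (ht : ∀ φ ψ, ∫ x, ψ x * B φ x = ∫ x, Bt ψ x * φ x)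
    (hc : ∀ h φ, B (heisSchwartz (heisAut g h) φ) = heisSchwartz h (B φ)) :
    ∃ U : L2Rn n ≃ₗᵢ[ℂ] L2Rn n, IsWeilOperator g U ∧
      ExtendsToTempered U (PointwiseConvergenceCLM.precomp ℂ Bt) := by
  have hd : DenseRange (toLpCLM ℂ ℂ 2 (volume : Measure (Rn n))) :=
    denseRange_toLpCLM ENNReal.ofNat_ne_top
  let U : L2Rn n ≃ₗᵢ[ℂ] L2Rn n := B.extendOfIsometry
    (toLpCLM ℂ ℂ 2 (volume : Measure (Rn n))).toLinearMap
    (toLpCLM ℂ ℂ 2 (volume : Measure (Rn n))).toLinearMap hd hd hn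
  have hUB : ∀ φ : 𝓢(Rn n, ℂ), U (φ.toLp 2) = (B φ).toLp 2 := fun φ =>
    B.extendOfIsometry_eq (toLpCLM ℂ ℂ 2 (volume : Measure (Rn n))).toLinearMap
      (toLpCLM ℂ ℂ 2 (volume : Measure (Rn n))).toLinearMap hd hd hn φ
  refine ⟨U, ?_, ?_⟩
  · rw [isWeilOperator_iff]
    intro h f
    refine hd.induction_on (p := fun f => U (heisRep (heisAut g h) f) = heisRep h (U f)) f
      (isClosed_eq (U.continuous.comp (isometry_heisRep _).continuous)
        ((isometry_heisRep h).continuous.comp U.continuous)) fun φ => ?_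
    simp only [toLpCLM_apply]
    rw [hUB, heisRep_toLp, heisRep_toLp, hUB, hc]
  · have hW : ∀ (χ : 𝓢'(Rn n, ℂ)) (ψ : 𝓢(Rn n, ℂ)),
        (PointwiseConvergenceCLM.precomp ℂ Bt χ) ψ = χ (Bt ψ) := fun χ ψ => rfl
    generalize (PointwiseConvergenceCLM.precomp ℂ Bt : 𝓢'(Rn n, ℂ) →L[ℂ] 𝓢'(Rn n, ℂ)) = W at hW
    intro f
    let e := Lp.toTemperedDistributionCLM ℂ (volume : Measure (Rn n)) 2
    have hcont : Continuous fun f => W (e f) := W.continuous.comp e.continuous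
    have hcont' : Continuous fun f => e (U f) := e.continuous.comp U.continuous
    refine hd.induction_on (p := fun f => W (e f) = e (U f)) f
      (isClosed_eq hcont hcont') fun φ => ?_
    ext ψ
    rw [toLpCLM_apply, hUB, hW]
    simp only [e, Lp.toTemperedDistributionCLM_apply]
    rw [toTemperedDistribution_toLp_apply, toTemperedDistribution_toLp_apply, ht]

/-! ### Irreducibility of the Heisenberg representation -/

open FourierTransform in
/-- An integrable function with vanishing Fourier transform vanishes almost everywhere. -/
theorem MeasureTheory.Integrable.ae_eq_zero_of_fourier_eq_zero {n : ℕ} {F : Rn n → ℂ}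
    (hF : Integrable F) (h : ∀ ξ, 𝓕 F ξ = 0) : F =ᵐ[volume] 0 := by
  have h1 : Lp.toTemperedDistributionCLM ℂ (volume : Measure (Rn n)) 1 (hF.toL1 F) = 0 := by
    ext φ
    rw [Lp.toTemperedDistributionCLM_apply, Lp.toTemperedDistribution_apply]
    have e1 : ∫ x, φ x • hF.toL1 F x = ∫ x, φ x • F x := by
      refine integral_congr_ae ?_
      filter_upwards [hF.coeFn_toL1] with x hx
      rw [hx]
    rw [e1]
    have h2 := VectorFourier.integral_fourierIntegral_smul_eq_flip (L := innerₗ (Rn n))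
      (μ := volume) (ν := volume) (f := (𝓕⁻ φ : 𝓢(Rn n, ℂ))) (g := F)
      Real.continuous_fourierChar continuous_inner (𝓕⁻ φ : 𝓢(Rn n, ℂ)).integrable hF
    have h3 : (VectorFourier.fourierIntegral Real.fourierChar volume (innerₗ (Rn n))
        (𝓕⁻ φ : 𝓢(Rn n, ℂ))) = φ := by
      have := congrArg (fun φ : 𝓢(Rn n, ℂ) => (φ : Rn n → ℂ)) 
        (FourierTransform.fourier_fourierInv_eq φ : 𝓕 (𝓕⁻ φ : 𝓢(Rn n, ℂ)) = φ)
      exact this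
    rw [h3, flip_innerₗ] at h2
    rw [h2]
    have h4 : ∀ ξ, VectorFourier.fourierIntegral Real.fourierChar volume (innerₗ (Rn n)) F ξ = 0 :=
      h
    simp [h4]
  have h2 : hF.toL1 F = 0 := by
    have := Lp.ker_toTemperedDistributionCLM_eq_bot (F := ℂ) (E := Rn n) (μ := volume) (p := 1)
    exact LinearMap.ker_eq_bot'.1 this _ h1
  have h3 := hF.coeFn_toL1
  rw [h2] at h3
  exact h3.symm.trans (Lp.coeFn_zero ℂ 1 volume)

/-- A function on `ℝⁿ` which is invariant, up to null sets, under every translation is constant. -/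
theorem ae_eq_const_of_forall_translate {n : ℕ} {m : Rn n → ℂ} (hm : Measurable m)
    (h : ∀ v : Rn n, ∀ᵐ x, m (x + v) = m x) : ∃ c : ℂ, ∀ᵐ x, m x = c := by
  have hs : MeasurableSet {p : Rn n × Rn n | m (p.2 + p.1) = m p.2} :=
    measurableSet_eq_fun (by fun_prop) (by fun_prop)
  have h1 := (Measure.ae_ae_comm (μ := (volume : Measure (Rn n)))
    (ν := (volume : Measure (Rn n))) (p := fun v x => m (x + v) = m x) hs).1
    (Filter.Eventually.of_forall h)
  obtain ⟨x, hx⟩ := h1.exists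
  refine ⟨m x, ?_⟩
  have h2 := (measurePreserving_add_left (volume : Measure (Rn n))
    (-x)).quasiMeasurePreserving.ae hx
  simpa using h2

/-- The Gaussian `exp (-‖x‖²)`. -/
noncomputable def gauss (n : ℕ) (x : Rn n) : ℂ := Complex.exp (-(‖x‖ : ℂ) ^ 2)

theorem gauss_ne_zero {n : ℕ} (x : Rn n) : gauss n x ≠ 0 := Complex.exp_ne_zero _

theorem star_gauss {n : ℕ} (x : Rn n) : star (gauss n x) = gauss n x := by
  simp [gauss, ← Complex.exp_conj]

theorem continuous_gauss (n : ℕ) : Continuous (gauss n) := by unfold gauss; fun_prop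

theorem memLp_gauss (n : ℕ) : MemLp (gauss n) 2 (volume : Measure (Rn n)) := by
  rw [memLp_two_iff_integrable_sq_norm (continuous_gauss n).aestronglyMeasurable]
  have := GaussianFourier.integrable_cexp_neg_mul_sq_norm_add (V := Rn n) (b := 2) (by simp) 0 0
  refine this.norm.congr (Filter.Eventually.of_forall fun x => ?_)
  simp only [gauss]
  rw [← norm_pow, ← Complex.exp_nat_mul]
  congr 2
  push_cast
  simp

/-- The element `(0, w, 0)` of the Heisenberg group. -/
def heisMod {n : ℕ} (w : Fin n → ℝ) : RealHeis n := ⟨0, w, 0⟩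

/-- The element `(v, 0, 0)` of the Heisenberg group. -/
def heisTrans {n : ℕ} (v : Fin n → ℝ) : RealHeis n := ⟨v, 0, 0⟩

open FourierTransform in
/-- A unitary operator which commutes with the modulations is a multiplication operator: for
`f, g ∈ L²`, the function `ḡ · V f` minus `f` times the conjugate of `V⁻¹ g` is integrable, and its
Fourier transform vanishes; then `g` is taken to be a Gaussian. -/
theorem exists_mul_of_commute {n : ℕ} (V : L2Rn n ≃ₗᵢ[ℂ] L2Rn n)
    (hV : ∀ w f, V (heisRep (heisMod w) f) = heisRep (heisMod w) (V f)) :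
    ∃ m : Rn n → ℂ, Measurable m ∧ ∀ f : L2Rn n, V f =ᵐ[volume] fun x => m x * f x := by
  set γ : L2Rn n := (memLp_gauss n).toLp (gauss n) with hγ
  have hγc : γ =ᵐ[volume] gauss n := (memLp_gauss n).coeFn_toLp
  refine ⟨fun x => star (V.symm γ x) / gauss n x, ?_, fun f => ?_⟩
  · exact (continuous_star.measurable.comp (Lp.stronglyMeasurable (V.symm γ)).measurable).div
      (continuous_gauss n).measurable
  have hint : ∀ a b : L2Rn n, Integrable (fun x => inner ℂ (a x) (b x)) :=
    fun a b => L2.integrable_inner a b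
  have key : (fun x => inner ℂ (γ x) (V f x) - inner ℂ (V.symm γ x) (f x)) =ᵐ[volume] 0 := by
    refine Integrable.ae_eq_zero_of_fourier_eq_zero ((hint _ _).sub (hint _ _)) fun ξ => ?_
    set w : Fin n → ℝ := -(√(2 * Real.pi) • ⇑ξ) with hw
    have hphase : ∀ x : Rn n, heisPhase (heisMod w) x = Real.fourierChar (-(inner ℝ x ξ)) := by
      intro x
      rw [heisPhase, Real.fourierChar_apply]
      congr 1
      have hs : √(2 * Real.pi) * √(2 * Real.pi) = 2 * Real.pi :=
        Real.mul_self_sqrt (by positivity)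
      have : inner ℝ x ξ = ⇑x ⬝ᵥ ⇑ξ := by
        simp [PiLp.inner_apply, dotProduct, mul_comm]
      simp only [heisMod, hw, this, dotProduct_neg, dotProduct_smul, smul_eq_mul, zero_dotProduct]
      congr 2
      linear_combination (-(⇑x ⬝ᵥ ⇑ξ)) * hs
    have hmod : ∀ a : L2Rn n, heisRep (heisMod w) a =ᵐ[volume]
        fun x => heisPhase (heisMod w) x * a x := by
      intro a
      filter_upwards [coeFn_heisRep (heisMod w) a] with x hx
      rw [hx, heisFun, mul_comm]
      simp [heisMod]
    have hin : ∀ a b : L2Rn n, inner ℂ a (heisRep (heisMod w) b) =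
        ∫ x, Real.fourierChar (-(inner ℝ x ξ)) • inner ℂ (a x) (b x) := by
      intro a b
      rw [L2.inner_def]
      refine integral_congr_ae ?_
      filter_upwards [hmod b] with x hx
      rw [hx, hphase, Circle.smul_def]
      simp only [RCLike.inner_apply, smul_eq_mul]
      ring
    have h1 : inner ℂ γ (heisRep (heisMod w) (V f)) =
        inner ℂ (V.symm γ) (heisRep (heisMod w) f) := by
      rw [← hV, ← V.inner_map_map (V.symm γ), V.apply_symm_apply]
    rw [hin, hin] at h1
    rw [Real.fourier_eq]
    simp only [smul_sub]
    rw [integral_sub, h1, sub_self]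
    · exact (Real.fourierIntegral_convergent_iff ξ).2 (hint _ _)
    · exact (Real.fourierIntegral_convergent_iff ξ).2 (hint _ _)
  filter_upwards [key, hγc] with x hx hg
  simp only [RCLike.inner_apply, Pi.zero_apply, sub_eq_zero, hg] at hx
  have hs := star_gauss x
  simp only [RCLike.star_def] at hs ⊢
  rw [hs] at hx
  rw [div_mul_eq_mul_div, eq_div_iff (gauss_ne_zero x), hx, mul_comm]

/-- Schur's lemma for the standard representation of the Heisenberg group. -/
theorem exists_smul_of_isWeilOperator_one {n : ℕ} {V : L2Rn n ≃ₗᵢ[ℂ] L2Rn n}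
    (hV : IsWeilOperator 1 V) : ∃ c : ℂ, c ≠ 0 ∧ ∀ f, V f = c • f := by
  have hV' : ∀ h f, V (heisRep h f) = heisRep h (V f) := by
    simpa only [isWeilOperator_iff, heisAut_one] using hV
  obtain ⟨m, hm, hmV⟩ := exists_mul_of_commute V fun w f => hV' _ f
  set γ : L2Rn n := (memLp_gauss n).toLp (gauss n) with hγ
  have hγc : γ =ᵐ[volume] gauss n := (memLp_gauss n).coeFn_toLp
  have htr : ∀ v : Rn n, ∀ᵐ x, m (x + v) = m x := by
    intro v
    set h : RealHeis n := heisTrans ((√(2 * Real.pi))⁻¹ • ⇑v) with hh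
    have hs : √(2 * Real.pi) ≠ 0 := by positivity
    have hv : √(2 * Real.pi) • WithLp.toLp 2 h.vPlus = v := by
      ext i
      exact mul_inv_cancel_left₀ hs (v i)
    have hfun : ∀ f x, heisFun h f x = f (x + v) := by
      intro f x
      rw [heisFun, hv]
      simp [heisPhase, hh, heisTrans]
    have e1 : V (heisRep h γ) =ᵐ[volume] fun x => m x * gauss n (x + v) := by
      filter_upwards [hmV (heisRep h γ), coeFn_heisRep h γ, heisFun_congr_ae h hγc] with x h1 h2 h3
      rw [h1, h2, h3, hfun]
    have e2 : heisRep h (V γ) =ᵐ[volume] fun x => m (x + v) * gauss n (x + v) := by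
      have h0 : V γ =ᵐ[volume] fun x => m x * gauss n x := by
        filter_upwards [hmV γ, hγc] with x h1 h2
        rw [h1, h2]
      filter_upwards [coeFn_heisRep h (V γ), heisFun_congr_ae h h0] with x h1 h2
      rw [h1, h2, hfun]
    rw [hV'] at e1
    filter_upwards [e1, e2] with x h1 h2
    exact mul_right_cancel₀ (gauss_ne_zero _) (h2.symm.trans h1)
  obtain ⟨c, hc⟩ := ae_eq_const_of_forall_translate hm htr
  have hVc : ∀ f, V f = c • f := by
    intro f
    refine Lp.ext ?_
    filter_upwards [hmV f, hc, Lp.coeFn_smul c f] with x h1 h2 h3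
    rw [h1, h2, h3]
    rfl
  refine ⟨c, ?_, hVc⟩
  rintro rfl
  have h0 : γ = 0 := by
    have := hVc γ
    rw [zero_smul] at this
    exact V.map_eq_zero_iff.1 this
  rw [h0] at hγc
  obtain ⟨x, hx⟩ := ((Lp.coeFn_zero ℂ 2 (volume : Measure (Rn n))).symm.trans hγc).exists
  exact gauss_ne_zero x hx.symm

/-- Two operators of the Weil representation corresponding to the same matrix are proportional. -/
theorem IsWeilOperator.exists_smul {n : ℕ} {g : symplecticGroup (Fin n) ℝ}
    {U V : L2Rn n ≃ₗᵢ[ℂ] L2Rn n} (hU : IsWeilOperator g U) (hV : IsWeilOperator g V) :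
    ∃ c : ℂ, c ≠ 0 ∧ ∀ f, V f = c • U f := by
  have := hU.symm.mul hV
  rw [inv_mul_cancel] at this
  obtain ⟨c, hc, h⟩ := exists_smul_of_isWeilOperator_one this
  refine ⟨c, hc, fun f => ?_⟩
  have := congrArg U (h f)
  simpa using this

/-! ### Lattice sums of Schwartz functions -/

/-- The integer vector `k` as an element of `ℝⁿ`. -/
def intVec {n : ℕ} (k : Fin n → ℤ) : Rn n := WithLp.toLp 2 fun i => (k i : ℝ)

theorem intVec_add {n : ℕ} (k m : Fin n → ℤ) : intVec (k + m) = intVec k + intVec m := by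
  ext i; simp [intVec]

theorem intVec_injective {n : ℕ} : Function.Injective (intVec (n := n)) := by
  intro k m h
  funext i
  have := congrArg (fun x : Rn n => x i) h
  simpa [intVec] using this

theorem summable_one_add_norm_intVec (n : ℕ) :
    Summable fun k : Fin n → ℤ => ((1 + ‖intVec k‖) ^ (n + 1))⁻¹ := by
  let b := (EuclideanSpace.basisFun (Fin n) ℝ).toBasis
  let L : Submodule ℤ (Rn n) := Submodule.span ℤ (Set.range b)
  have hfin : Module.finrank ℤ L = n := by
    rw [Module.finrank_eq_card_basis (b.restrictScalars ℤ), Fintype.card_fin]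
  have hmem : ∀ k : Fin n → ℤ, intVec k ∈ L := by
    intro k
    have : intVec k = ∑ i, k i • b i := by
      ext j
      simp [intVec, b, Finset.sum_apply, Pi.single_apply]
    rw [this]
    exact Submodule.sum_mem _ fun i _ =>
      Submodule.smul_mem _ _ (Submodule.subset_span (Set.mem_range_self i))
  have h1 := ZLattice.summable_norm_pow_inv L (n + 1) (by omega)
  have h2 := h1.comp_injective (i := fun k : Fin n → ℤ => (⟨intVec k, hmem k⟩ : L))
    fun k m h => intVec_injective (congrArg Subtype.val h)
  refine h2.of_norm_bounded_eventually ?_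
  rw [Filter.eventually_cofinite]
  refine (Set.finite_singleton (0 : Fin n → ℤ)).subset fun k hk => ?_
  by_contra h0
  refine hk ?_
  have hpos : 0 < ‖intVec k‖ := by
    rw [norm_pos_iff]
    intro h
    refine h0 (intVec_injective (h.trans ?_))
    ext i; simp [intVec]
  have : ‖(⟨intVec k, hmem k⟩ : L)‖ = ‖intVec k‖ := rfl
  simp only [Function.comp_apply, this]
  rw [Real.norm_of_nonneg (by positivity), inv_pow]
  gcongr
  linarith

/-- Values of a Schwartz function along a family of points growing at least as fast as `ℤⁿ`. -/
theorem SchwartzMap.norm_apply_le_of_growth {n : ℕ} {C : ℝ} {k : Fin n → ℤ} {x : Rn n}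
    (h : 1 + ‖intVec k‖ ≤ C * (1 + ‖x‖)) (φ : 𝓢(Rn n, ℂ)) :
    ‖φ x‖ ≤ ((1 + ‖intVec k‖) ^ (n + 1))⁻¹ * (C ^ (n + 1) * 2 ^ (n + 1)) *
      ((Finset.Iic (n + 1, 0)).sup (schwartzSeminormFamily ℂ (Rn n) ℂ)) φ := by
  have h1 := one_add_le_sup_seminorm_apply (𝕜 := ℂ) (m := (n + 1, 0)) le_rfl le_rfl φ x
  rw [norm_iteratedFDeriv_zero] at h1
  rw [mul_assoc, inv_mul_eq_div, le_div_iff₀ (by positivity)]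
  have hk : 0 ≤ 1 + ‖intVec k‖ := by positivity
  have hC : 0 ≤ C := by
    by_contra! hC
    have : C * (1 + ‖x‖) ≤ 0 := mul_nonpos_of_nonpos_of_nonneg hC.le (by positivity)
    have : 0 < 1 + ‖intVec k‖ := by positivity
    linarith
  calc ‖φ x‖ * (1 + ‖intVec k‖) ^ (n + 1) ≤ ‖φ x‖ * (C * (1 + ‖x‖)) ^ (n + 1) := by gcongr
    _ = C ^ (n + 1) * ((1 + ‖x‖) ^ (n + 1) * ‖φ x‖) := by rw [mul_pow]; ring
    _ ≤ C ^ (n + 1) * (2 ^ (n + 1) *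
      ((Finset.Iic (n + 1, 0)).sup (schwartzSeminormFamily ℂ (Rn n) ℂ)) φ) :=
        mul_le_mul_of_nonneg_left h1 (by positivity)
    _ = _ := by ring

theorem SchwartzMap.summable_norm_of_growth {n : ℕ} {C : ℝ} {p : (Fin n → ℤ) → Rn n}
    (h : ∀ k, 1 + ‖intVec k‖ ≤ C * (1 + ‖p k‖)) (φ : 𝓢(Rn n, ℂ)) :
    Summable fun k => ‖φ (p k)‖ :=
  Summable.of_nonneg_of_le (fun _ => norm_nonneg _) (fun k => φ.norm_apply_le_of_growth (h k))
    (((summable_one_add_norm_intVec n).mul_right _).mul_right _)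

/-- The tempered distribution `∑ₖ δ(x - pₖ)` for a family of points growing at least as fast
as `ℤⁿ`. -/
theorem exists_hasSum_delta_of_growth {n : ℕ} {C : ℝ} {p : (Fin n → ℤ) → Rn n}
    (h : ∀ k, 1 + ‖intVec k‖ ≤ C * (1 + ‖p k‖)) :
    ∃ χ : 𝓢'(Rn n, ℂ), ∀ φ : 𝓢(Rn n, ℂ), HasSum (fun k => φ (p k)) (χ φ) := by
  have hs : ∀ φ : 𝓢(Rn n, ℂ), Summable fun k => φ (p k) :=
    fun φ => (φ.summable_norm_of_growth h).of_norm
  have hS := (summable_one_add_norm_intVec n).mul_right (C ^ (n + 1) * 2 ^ (n + 1))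
  let Λ : 𝓢(Rn n, ℂ) →L[ℂ] ℂ := mkCLMtoNormedSpace (fun φ => ∑' k, φ (p k))
    (fun φ ψ => by simpa using (hs φ).tsum_add (hs ψ))
    (fun c φ => by simpa using (hs φ).tsum_mul_left c)
    ⟨Finset.Iic (n + 1, 0), |∑' k : Fin n → ℤ, ((1 + ‖intVec k‖) ^ (n + 1))⁻¹ *
        (C ^ (n + 1) * 2 ^ (n + 1))|, abs_nonneg _, fun φ => by
      calc ‖∑' k, φ (p k)‖ ≤ ∑' k, ‖φ (p k)‖ :=
            norm_tsum_le_tsum_norm (φ.summable_norm_of_growth h)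
        _ ≤ ∑' k : Fin n → ℤ, ((1 + ‖intVec k‖) ^ (n + 1))⁻¹ * (C ^ (n + 1) * 2 ^ (n + 1)) *
            ((Finset.Iic (n + 1, 0)).sup (schwartzSeminormFamily ℂ (Rn n) ℂ)) φ :=
            (φ.summable_norm_of_growth h).tsum_le_tsum
              (fun k => φ.norm_apply_le_of_growth (h k)) (hS.mul_right _)
        _ ≤ _ := by
            rw [hS.tsum_mul_right]
            gcongr
            exact le_abs_self _⟩
  exact ⟨ContinuousLinearMap.toPointwiseConvergenceCLM _ _ _ _ Λ, fun φ => (hs φ).hasSum⟩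

theorem hasSum_delta_iff {n : ℕ} {p : (Fin n → ℤ) → Rn n} {χ : 𝓢'(Rn n, ℂ)} :
    HasSum (fun k => TemperedDistribution.delta (p k)) χ ↔
      ∀ φ : 𝓢(Rn n, ℂ), HasSum (fun k => φ (p k)) (χ φ) := by
  rw [HasSum, PointwiseConvergenceCLM.tendsto_iff_forall_tendsto]
  refine forall_congr' fun φ => ?_
  rw [HasSum]
  have : ∀ s : Finset (Fin n → ℤ), (∑ k ∈ s, TemperedDistribution.delta (p k)) φ =
      ∑ k ∈ s, φ (p k) := fun s =>
    map_sum (PointwiseConvergenceCLM.evalCLM (RingHom.id ℂ) ℂ φ) _ s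
  simp only [this]

/-! ### Rational lattices and periodic phases -/

theorem det_ne_zero_of_linearIndependent {n : ℕ} {a : Matrix (Fin n) (Fin n) ℚ}
    (ha : LinearIndependent ℚ a) : a.det ≠ 0 :=
  ((Matrix.isUnit_iff_isUnit_det a).1 (Matrix.linearIndependent_rows_iff_isUnit.1 ha)).ne_zero

theorem linearIndependent_of_det_ne_zero {n : ℕ} {a : Matrix (Fin n) (Fin n) ℚ}
    (ha : a.det ≠ 0) : LinearIndependent ℚ a :=
  Matrix.linearIndependent_rows_iff_isUnit.2 ((Matrix.isUnit_iff_isUnit_det a).2 ha.isUnit)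

/-- The rational row `r` as an element of `ℝⁿ`, rescaled by `√(2π)`. -/
noncomputable def ratPoint {n : ℕ} (r : Fin n → ℚ) : Rn n :=
  √(2 * Real.pi) • WithLp.toLp 2 fun i => (r i : ℝ)

theorem latticePoint_eq {n : ℕ} (a : Matrix (Fin n) (Fin n) ℚ) (b : Fin n → ℚ) (k : Fin n → ℤ) :
    latticePoint a b k = ratPoint (b + (fun i => (k i : ℚ)) ᵥ* a) := rfl

theorem exists_latticePoint_growth {n : ℕ} {a : Matrix (Fin n) (Fin n) ℚ} (ha : a.det ≠ 0)
    (b : Fin n → ℚ) : ∃ C : ℝ, ∀ k, 1 + ‖intVec k‖ ≤ C * (1 + ‖latticePoint a b k‖) := by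
  let E : Rn n →L[ℝ] Rn n := LinearMap.toContinuousLinearMap
    (Matrix.toEuclideanLin (a⁻¹.map (fun q : ℚ => (q : ℝ)))ᵀ)
  have hE : ∀ r : Fin n → ℚ, E (ratPoint r) = ratPoint (r ᵥ* a⁻¹) := by
    intro r
    ext i
    simp [E, ratPoint, Matrix.toLpLin_apply, Matrix.mulVec_transpose, Matrix.vecMul, dotProduct]
  have hs : 0 < √(2 * Real.pi) := by positivity
  have hk : ∀ k, intVec k = (√(2 * Real.pi))⁻¹ •
      (E (latticePoint a b k) - ratPoint (b ᵥ* a⁻¹)) := by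
    intro k
    rw [latticePoint_eq, hE, Matrix.add_vecMul, Matrix.vecMul_vecMul,
      Matrix.mul_nonsing_inv _ ha.isUnit, Matrix.vecMul_one]
    ext i
    simp only [intVec, ratPoint, PiLp.smul_apply, PiLp.sub_apply, Pi.add_apply, smul_eq_mul]
    push_cast
    rw [← mul_sub, add_sub_cancel_left, inv_mul_cancel_left₀ hs.ne']
  set s := (√(2 * Real.pi))⁻¹ with hs'
  have hs0 : 0 < s := inv_pos.2 hs
  refine ⟨1 + s * (‖E‖ + ‖ratPoint (b ᵥ* a⁻¹)‖), fun k => ?_⟩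
  have h1 : ‖intVec k‖ ≤ s * (‖E‖ * ‖latticePoint a b k‖ + ‖ratPoint (b ᵥ* a⁻¹)‖) := by
    rw [hk k, norm_smul, Real.norm_of_nonneg hs0.le]
    gcongr
    exact (norm_sub_le _ _).trans (by gcongr; exact E.le_opNorm _)
  have h2 : 0 ≤ s * ‖E‖ := by positivity
  have h3 : 0 ≤ s * ‖ratPoint (b ᵥ* a⁻¹)‖ * ‖latticePoint a b k‖ := by positivity
  nlinarith [norm_nonneg (latticePoint a b k)]

theorem mem_poissonSpace_of_hasSum {n : ℕ} {a : Matrix (Fin n) (Fin n) ℚ} (ha : a.det ≠ 0)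
    {b : Fin n → ℚ} {χ : 𝓢'(Rn n, ℂ)}
    (h : ∀ φ : 𝓢(Rn n, ℂ), HasSum (fun k => φ (latticePoint a b k)) (χ φ)) :
    χ ∈ poissonSpace n :=
  Submodule.subset_span ⟨a, b, linearIndependent_of_det_ne_zero ha, hasSum_delta_iff.2 h⟩

/-- Division with remainder of integer vectors by `N`. -/
def vecDivMod (n N : ℕ) [NeZero N] : (Fin n → Fin N) × (Fin n → ℤ) ≃ (Fin n → ℤ) :=
  ((Equiv.piCongrRight fun _ => (Int.divModEquiv N).trans (Equiv.prodComm _ _)).trans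
    (Equiv.arrowProdEquivProdArrow _ _ _)).symm

theorem vecDivMod_apply (n N : ℕ) [NeZero N] (r : Fin n → Fin N) (m : Fin n → ℤ) :
    vecDivMod n N (r, m) = (fun i => ((r i : ℕ) : ℤ)) + (N : ℤ) • m := by
  funext i
  simp [vecDivMod, Equiv.piCongrRight, Equiv.arrowProdEquivProdArrow, Int.divModEquiv]
  ring

/-- A lattice sum of delta functions with coefficients that are periodic is a linear combination
of sums over cosets of a sublattice. -/
theorem mem_poissonSpace_of_periodic {n : ℕ} {a : Matrix (Fin n) (Fin n) ℚ} (ha : a.det ≠ 0)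
    {b : Fin n → ℚ} {c : (Fin n → ℤ) → ℂ} {N : ℕ} (hN : N ≠ 0)
    (hc : ∀ k m, c (k + (N : ℤ) • m) = c k) {χ : 𝓢'(Rn n, ℂ)}
    (h : ∀ φ : 𝓢(Rn n, ℂ), HasSum (fun k => c k * φ (latticePoint a b k)) (χ φ)) :
    χ ∈ poissonSpace n := by
  have : NeZero N := ⟨hN⟩
  let a' : Matrix (Fin n) (Fin n) ℚ := (N : ℚ) • a
  have ha' : a'.det ≠ 0 := by
    rw [Matrix.det_smul]
    exact mul_ne_zero (pow_ne_zero _ (by exact_mod_cast hN)) ha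
  let b' : (Fin n → Fin N) → Fin n → ℚ := fun r => b + (fun i => ((r i : ℕ) : ℚ)) ᵥ* a
  have hp : ∀ r m, latticePoint a b (vecDivMod n N (r, m)) = latticePoint a' (b' r) m := by
    intro r m
    rw [vecDivMod_apply, latticePoint_eq, latticePoint_eq, add_assoc]
    congr 2
    rw [Matrix.vecMul_smul, ← Matrix.smul_vecMul, ← Matrix.add_vecMul]
    congr 1
    funext i
    simp
  have hex : ∀ r, ∃ ψ : 𝓢'(Rn n, ℂ), ∀ φ : 𝓢(Rn n, ℂ),
      HasSum (fun m => φ (latticePoint a' (b' r) m)) (ψ φ) := fun r =>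
    exists_hasSum_delta_of_growth (exists_latticePoint_growth ha' (b' r)).choose_spec
  choose ψ hψ using hex
  let c' : (Fin n → Fin N) → ℂ := fun r => c fun i => ((r i : ℕ) : ℤ)
  have hχ : χ = ∑ r, c' r • ψ r := by
    ext φ
    have h1 := ((vecDivMod n N).hasSum_iff.2 (h φ)).prod_fiberwise
      (g := fun r => c' r * ψ r φ) fun r => by
        simp only [Function.comp_apply, hp]
        simp only [vecDivMod_apply, hc]
        exact (hψ r φ).mul_left _
    have h2 : (∑ r, c' r • ψ r) φ = ∑ r, c' r * ψ r φ :=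
      map_sum (PointwiseConvergenceCLM.evalCLM (RingHom.id ℂ) ℂ φ) _ _
    rw [h2]
    exact h1.unique (hasSum_fintype _)
  rw [hχ]
  exact Submodule.sum_mem _ fun r _ =>
    Submodule.smul_mem _ _ (mem_poissonSpace_of_hasSum ha' (hψ r))

/-- The value at `k` of the quadratic polynomial `k Q kᵗ + k uᵗ + s` with rational coefficients. -/
def ratQuad {n : ℕ} (Q : Matrix (Fin n) (Fin n) ℚ) (u : Fin n → ℚ) (s : ℚ) (k : Fin n → ℤ) : ℚ :=
  ((fun i => (k i : ℚ)) ᵥ* Q) ⬝ᵥ (fun i => (k i : ℚ)) + (fun i => (k i : ℚ)) ⬝ᵥ u + s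

theorem exists_intMultiple {ι : Type*} [Finite ι] (f : ι → ℚ) :
    ∃ D : ℕ, D ≠ 0 ∧ ∀ i, ∃ z : ℤ, (D : ℚ) * f i = z := by
  obtain ⟨d, hd⟩ := IsLocalization.exist_integer_multiples_of_finite (nonZeroDivisors ℤ) f
  refine ⟨(d : ℤ).natAbs, Int.natAbs_ne_zero.2 (nonZeroDivisors.ne_zero d.2), fun i => ?_⟩
  obtain ⟨z, hz⟩ := hd i
  have hz' : ((d : ℤ) : ℚ) * f i = z := by simpa [Submonoid.smul_def] using hz.symm
  rcases Int.natAbs_eq (d : ℤ) with h | h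
  · exact ⟨z, by rw [← hz', ← Int.cast_natCast]; congr 1; exact congrArg Int.cast h.symm⟩
  · refine ⟨-z, ?_⟩
    push_cast
    rw [← hz', ← neg_mul]
    congr 1
    rw [← Int.cast_natCast, ← Int.cast_neg]
    exact congrArg Int.cast (by omega)

/-- The phase `exp (π i q(k))` with a rational quadratic polynomial `q` is a periodic function
of `k`. -/
theorem exists_period_ratQuad {n : ℕ} (Q : Matrix (Fin n) (Fin n) ℚ) (u : Fin n → ℚ) (s : ℚ) :
    ∃ N : ℕ, N ≠ 0 ∧ ∀ k m, Complex.exp (((Real.pi * ratQuad Q u s (k + (N : ℤ) • m) : ℝ) : ℂ) *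
      Complex.I) = Complex.exp (((Real.pi * ratQuad Q u s k : ℝ) : ℂ) * Complex.I) := by
  obtain ⟨D, hD, hDz⟩ := exists_intMultiple (Sum.elim (fun ij : Fin n × Fin n => Q ij.1 ij.2) u)
  choose z hz using hDz
  let Qz : Matrix (Fin n) (Fin n) ℤ := fun i j => z (Sum.inl (i, j))
  let uz : Fin n → ℤ := fun i => z (Sum.inr i)
  have hQ : (D : ℚ) • Q = Qz.map (fun t : ℤ => (t : ℚ)) := by
    ext i j; exact hz (Sum.inl (i, j))
  have hu : (D : ℚ) • u = fun i => (uz i : ℚ) := by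
    ext i; exact hz (Sum.inr i)
  have hbil : ∀ x y : Fin n → ℤ, (D : ℚ) * (((fun i => (x i : ℚ)) ᵥ* Q) ⬝ᵥ fun i => (y i : ℚ)) =
      ((x ᵥ* Qz) ⬝ᵥ y : ℤ) := by
    intro x y
    rw [← smul_eq_mul, ← smul_dotProduct, ← Matrix.vecMul_smul, hQ]
    simp [Matrix.vecMul, dotProduct]
  have hlin : ∀ x : Fin n → ℤ, (D : ℚ) * ((fun i => (x i : ℚ)) ⬝ᵥ u) = (x ⬝ᵥ uz : ℤ) := by
    intro x
    rw [← smul_eq_mul, ← dotProduct_smul, hu]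
    simp [dotProduct]
  refine ⟨2 * D, by omega, fun k m => ?_⟩
  set w : ℤ := (m ᵥ* Qz) ⬝ᵥ k + (k ᵥ* Qz) ⬝ᵥ m + 2 * D * ((m ᵥ* Qz) ⬝ᵥ m) + m ⬝ᵥ uz with hw
  have hdiff : ratQuad Q u s (k + ((2 * D : ℕ) : ℤ) • m) = ratQuad Q u s k + 2 * w := by
    have hc : (fun i => (((k + ((2 * D : ℕ) : ℤ) • m) i : ℤ) : ℚ)) =
        (fun i => (k i : ℚ)) + (2 * D : ℚ) • fun i => (m i : ℚ) := by
      funext i; simp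
    rw [ratQuad, ratQuad, hc, hw]
    simp only [Matrix.add_vecMul, Matrix.smul_vecMul, add_dotProduct, dotProduct_add,
      smul_dotProduct, dotProduct_smul, smul_eq_mul]
    push_cast
    rw [← hbil, ← hbil, ← hbil, ← hlin]
    ring
  rw [hdiff]
  have : (((Real.pi * ((ratQuad Q u s k + 2 * w : ℚ) : ℝ) : ℝ) : ℂ) * Complex.I) =
      ((Real.pi * ratQuad Q u s k : ℝ) : ℂ) * Complex.I + w * (2 * Real.pi * Complex.I) := by
    push_cast
    ring
  rw [this, Complex.exp_add, Complex.exp_int_mul_two_pi_mul_I, mul_one]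

/-- A sum of delta functions over a rational lattice, with a phase which is quadratic with
rational coefficients, is a Poisson distribution. -/
theorem mem_poissonSpace_of_ratQuad {n : ℕ} {a : Matrix (Fin n) (Fin n) ℚ} (ha : a.det ≠ 0)
    {b : Fin n → ℚ} (Q : Matrix (Fin n) (Fin n) ℚ) (u : Fin n → ℚ) (s : ℚ) {χ : 𝓢'(Rn n, ℂ)}
    (h : ∀ φ : 𝓢(Rn n, ℂ), HasSum (fun k =>
      Complex.exp (((Real.pi * ratQuad Q u s k : ℝ) : ℂ) * Complex.I) *
        φ (latticePoint a b k)) (χ φ)) :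
    χ ∈ poissonSpace n := by
  obtain ⟨N, hN, hper⟩ := exists_period_ratQuad Q u s
  exact mem_poissonSpace_of_periodic ha hN hper h

/-- An operator on `𝓢'` preserves `𝒫` as soon as it maps the generators to `𝒫`. -/
theorem map_mem_poissonSpace {n : ℕ} {W : 𝓢'(Rn n, ℂ) →L[ℂ] 𝓢'(Rn n, ℂ)}
    (h : ∀ (a : Matrix (Fin n) (Fin n) ℚ) (b : Fin n → ℚ) (χ : 𝓢'(Rn n, ℂ)), a.det ≠ 0 →
      (∀ φ : 𝓢(Rn n, ℂ), HasSum (fun k => φ (latticePoint a b k)) (χ φ)) → W χ ∈ poissonSpace n)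
    {χ : 𝓢'(Rn n, ℂ)} (hχ : χ ∈ poissonSpace n) : W χ ∈ poissonSpace n := by
  have : poissonSpace n ≤ (poissonSpace n).comap (W : 𝓢'(Rn n, ℂ) →ₗ[ℂ] 𝓢'(Rn n, ℂ)) := by
    refine Submodule.span_le.2 ?_
    rintro χ ⟨a, b, ha, hs⟩
    exact h a b χ (det_ne_zero_of_linearIndependent ha) (hasSum_delta_iff.1 hs)
  exact this hχ

/-! ### Poisson summation in several variables -/

/-- The projection of `ℝⁿ` onto the torus. -/
def toTorus {n : ℕ} (y : Fin n → ℝ) : UnitAddTorus (Fin n) := fun i => (y i : UnitAddCircle)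

theorem isQuotientMap_toTorus (n : ℕ) : Topology.IsQuotientMap (toTorus (n := n)) := by
  have hc : Continuous (toTorus (n := n)) :=
    continuous_pi fun i => (AddCircle.continuous_mk' 1).comp (continuous_apply i)
  have hs : Function.Surjective (toTorus (n := n)) := fun z =>
    ⟨fun i => (QuotientAddGroup.mk_surjective (z i)).choose,
      funext fun i => (QuotientAddGroup.mk_surjective (z i)).choose_spec⟩
  have ho : IsOpenMap (toTorus (n := n)) :=
    IsOpenMap.piMap (fun _ => QuotientAddGroup.isOpenMap_coe)
      (Filter.Eventually.of_forall fun _ => QuotientAddGroup.mk_surjective)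
  exact ho.isQuotientMap hc hs

theorem exists_int_of_toTorus_eq {n : ℕ} {y z : Fin n → ℝ} (h : toTorus y = toTorus z) :
    ∃ k : Fin n → ℤ, ∀ i, z i = y i + k i := by
  have : ∀ i, ∃ k : ℤ, z i = y i + k := by
    intro i
    have hi : (y i : UnitAddCircle) = (z i : UnitAddCircle) := congrFun h i
    rw [QuotientAddGroup.eq] at hi
    obtain ⟨k, hk⟩ := AddSubgroup.mem_zmultiples_iff.1 hi
    refine ⟨k, ?_⟩
    simp at hk
    linarith
  choose k hk using this
  exact ⟨k, hk⟩

theorem mFourier_toTorus {n : ℕ} (m : Fin n → ℤ) (y : Fin n → ℝ) :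
    UnitAddTorus.mFourier m (toTorus y) =
      Complex.exp (((2 * Real.pi * ((fun i => (m i : ℝ)) ⬝ᵥ y) : ℝ) : ℂ) * Complex.I) := by
  simp only [UnitAddTorus.mFourier, ContinuousMap.coe_mk, toTorus, fourier_coe_apply,
    ← Complex.exp_sum]
  congr 1
  simp only [dotProduct]
  push_cast
  rw [Finset.mul_sum, Finset.sum_mul]
  refine Finset.sum_congr rfl fun i _ => ?_
  simp
  ring

theorem growth_of_norm_le {n : ℕ} {R : ℝ} {x : Rn n} (hx : ‖x‖ ≤ R) (k : Fin n → ℤ) :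
    1 + ‖intVec k‖ ≤ (1 + R) * (1 + ‖x + intVec k‖) := by
  have h1 : ‖intVec k‖ ≤ ‖x + intVec k‖ + ‖x‖ := by
    simpa using norm_sub_le (x + intVec k) x
  have h2 : 0 ≤ R := (norm_nonneg x).trans hx
  nlinarith [norm_nonneg (x + intVec k)]

/-- The periodization `∑ₖ φ (y + k)` of a Schwartz function. -/
noncomputable def periodization {n : ℕ} (φ : 𝓢(Rn n, ℂ)) (y : Fin n → ℝ) : ℂ :=
  ∑' k : Fin n → ℤ, φ (WithLp.toLp 2 y + intVec k)

theorem summable_periodization {n : ℕ} (φ : 𝓢(Rn n, ℂ)) (x : Rn n) :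
    Summable fun k : Fin n → ℤ => φ (x + intVec k) :=
  (φ.summable_norm_of_growth (growth_of_norm_le le_rfl)).of_norm

theorem continuous_periodization {n : ℕ} (φ : 𝓢(Rn n, ℂ)) : Continuous (periodization φ) := by
  have h : Continuous fun x : Rn n => ∑' k : Fin n → ℤ, φ (x + intVec k) := by
    rw [continuous_iff_continuousAt]
    intro x
    have hon : ContinuousOn (fun x : Rn n => ∑' k : Fin n → ℤ, φ (x + intVec k))
        (Metric.closedBall 0 (‖x‖ + 1)) := by
      refine continuousOn_tsum (fun k => by fun_prop)
        (((summable_one_add_norm_intVec n).mul_right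
          ((1 + (‖x‖ + 1)) ^ (n + 1) * 2 ^ (n + 1))).mul_right
          (((Finset.Iic (n + 1, 0)).sup (schwartzSeminormFamily ℂ (Rn n) ℂ)) φ))
        fun k y hy => ?_
      exact φ.norm_apply_le_of_growth (growth_of_norm_le (mem_closedBall_zero_iff.1 hy) k)
    refine hon.continuousAt (Filter.mem_of_superset (Metric.ball_mem_nhds x one_pos) fun y hy => ?_)
    rw [mem_closedBall_zero_iff]
    have := norm_sub_norm_le y x
    rw [mem_ball_iff_norm] at hy
    linarith
  exact h.comp (PiLp.continuous_toLp 2 _)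

theorem periodization_add_int {n : ℕ} (φ : 𝓢(Rn n, ℂ)) (y : Fin n → ℝ) (k : Fin n → ℤ) :
    periodization φ (fun i => y i + k i) = periodization φ y := by
  have : (WithLp.toLp 2 (fun i => y i + k i) : Rn n) = WithLp.toLp 2 y + intVec k := by
    ext i; simp [intVec]
  rw [periodization, this, periodization, 
    ← (Equiv.addLeft k).tsum_eq fun m => φ (WithLp.toLp 2 y + intVec m)]
  simp only [Equiv.coe_addLeft, intVec_add, add_assoc]

/-- The integral over `ℝⁿ` is the sum over integer translates of integrals over a unit cube. -/
theorem hasSum_integral_cube {n : ℕ} {E : Type*} [NormedAddCommGroup E] [NormedSpace ℝ E]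
    {H : (Fin n → ℝ) → E} (hH : Integrable H) :
    HasSum (fun k : Fin n → ℤ => ∫ y in {y : Fin n → ℝ | ∀ i, y i ∈ Set.Ioc (0 : ℝ) (0 + 1)},
      H (fun i => y i + k i)) (∫ y, H y) := by
  let s : (Fin n → ℤ) → Set (Fin n → ℝ) := fun k =>
    {y | ∀ i, y i ∈ Set.Ioc (k i : ℝ) (k i + 1)}
  have hpi : ∀ k, s k = Set.univ.pi fun i => Set.Ioc (k i : ℝ) (k i + 1) := by
    intro k; ext y; simp [s]
  have hm : ∀ k, MeasurableSet (s k) := by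
    intro k
    rw [hpi]
    exact MeasurableSet.univ_pi fun i => measurableSet_Ioc
  have hceil : ∀ k y, y ∈ s k → ∀ i, k i = ⌈y i⌉ - 1 := by
    intro k y hy i
    have h := hy i
    have : ⌈y i⌉ = k i + 1 := Int.ceil_eq_iff.2 ⟨by push_cast; linarith [h.1], by
      push_cast; exact h.2⟩
    omega
  have hd : Pairwise (Function.onFun Disjoint s) := by
    intro k m hkm
    refine Set.disjoint_left.2 fun y hy hy' => hkm (funext fun i => ?_)
    rw [hceil k y hy i, hceil m y hy' i]
  have hU : ⋃ k, s k = Set.univ := by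
    refine Set.eq_univ_of_forall fun y => Set.mem_iUnion.2 ⟨fun i => ⌈y i⌉ - 1, fun i => ?_⟩
    have := Int.ceil_lt_add_one (y i)
    have := Int.le_ceil (y i)
    push_cast
    constructor <;> linarith
  have h1 := hasSum_integral_iUnion hm hd (f := H) (μ := volume) (by rw [hU]; exact hH.integrableOn)
  rw [hU, setIntegral_univ] at h1
  refine h1.congr_fun fun k => ?_
  have hmp := measurePreserving_add_right (volume : Measure (Fin n → ℝ)) (fun i => (k i : ℝ))
  have := hmp.setIntegral_preimage_emb (measurableEmbedding_addRight _) H (s k)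
  rw [← this]
  have hset : (fun y : Fin n → ℝ => y + fun i => (k i : ℝ)) ⁻¹' s k =
      {y : Fin n → ℝ | ∀ i, y i ∈ Set.Ioc (0 : ℝ) (0 + 1)} := by
    ext y
    refine forall_congr' fun i => ?_
    simp only [Pi.add_apply, Set.mem_Ioc]
    constructor <;> rintro ⟨h1, h2⟩ <;> constructor <;> linarith
  rw [hset]
  rfl

open FourierTransform in
/-- Poisson summation for Schwartz functions in several variables. -/
theorem SchwartzMap.hasSum_poisson {n : ℕ} (φ : 𝓢(Rn n, ℂ)) (y : Fin n → ℝ) :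
    HasSum (fun m : Fin n → ℤ => 𝓕 φ (intVec m) *
      Complex.exp (((2 * Real.pi * ((fun i => (m i : ℝ)) ⬝ᵥ y) : ℝ) : ℂ) * Complex.I))
      (periodization φ y) := by
  have hlift : ∀ ⦃y z⦄, toTorus y = toTorus z → periodization φ y = periodization φ z := by
    intro y z h
    obtain ⟨k, hk⟩ := exists_int_of_toTorus_eq h
    rw [funext hk, periodization_add_int]
  let q : C(Fin n → ℝ, UnitAddTorus (Fin n)) := ⟨toTorus, (isQuotientMap_toTorus n).continuous⟩
  have hq : Topology.IsQuotientMap q := isQuotientMap_toTorus n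
  let F : C(UnitAddTorus (Fin n), ℂ) :=
    hq.lift ⟨periodization φ, continuous_periodization φ⟩ hlift
  have hF : ∀ y, F (toTorus y) = periodization φ y := fun y =>
    congrArg (fun G : C(Fin n → ℝ, ℂ) => G y)
      (hq.lift_comp ⟨periodization φ, continuous_periodization φ⟩ hlift)
  have hcoef : ∀ m : Fin n → ℤ, UnitAddTorus.mFourierCoeff F m = 𝓕 φ (intVec m) := by
    intro m
    let e : (Fin n → ℝ) → ℂ := fun y => UnitAddTorus.mFourier (-m) (toTorus y)
    let H : (Fin n → ℝ) → ℂ := fun y => e y * φ (WithLp.toLp 2 y)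
    have hemb := (MeasurableEquiv.toLp 2 (Fin n → ℝ)).measurableEmbedding
    have hφi : Integrable fun y : Fin n → ℝ => φ (WithLp.toLp 2 y) :=
      ((PiLp.volume_preserving_toLp (Fin n)).integrable_comp_emb hemb).2 φ.integrable
    have hec : Continuous e :=
      (UnitAddTorus.mFourier (-m)).continuous.comp (isQuotientMap_toTorus n).continuous
    have hen : ∀ y, ‖e y‖ = 1 := by
      intro y
      simp only [e, mFourier_toTorus, Complex.norm_exp_ofReal_mul_I]
    have hHi : Integrable H := by
      refine hφi.bdd_mul (c := 1) hec.aestronglyMeasurable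
        (Filter.Eventually.of_forall fun y => (hen y).le)
    have htr : ∀ (y : Fin n → ℝ) (k : Fin n → ℤ), H (fun i => y i + k i) =
        e y * φ (WithLp.toLp 2 y + intVec k) := by
      intro y k
      have h1 : (WithLp.toLp 2 (fun i => y i + k i) : Rn n) = WithLp.toLp 2 y + intVec k := by
        ext i; simp [intVec]
      have h2 : toTorus (fun i => y i + (k i : ℝ)) = toTorus y := by
        funext i
        simp only [toTorus]
        rw [QuotientAddGroup.eq]
        exact AddSubgroup.mem_zmultiples_iff.2 ⟨-k i, by simp⟩
      simp only [H, e, h1, h2]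
    have hsum := hasSum_integral_cube hHi
    have hnsum := hasSum_integral_cube hHi.norm
    have h3 := hasSum_integral_of_summable_integral_norm
      (μ := volume.restrict {y : Fin n → ℝ | ∀ i, y i ∈ Set.Ioc (0 : ℝ) (0 + 1)})
      (F := fun (k : Fin n → ℤ) y => H (fun i => y i + k i))
      (fun k => ((measurePreserving_add_right (volume : Measure (Fin n → ℝ))
        (fun i => (k i : ℝ))).integrable_comp_emb
            (measurableEmbedding_addRight _)).2 hHi |>.restrict)
      hnsum.summable
    rw [UnitAddTorus.mFourierCoeff_eq_integral F m 0]
    calc _ = ∫ y in {y : Fin n → ℝ | ∀ i, y i ∈ Set.Ioc (0 : ℝ) (0 + 1)},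
          ∑' k : Fin n → ℤ, H (fun i => y i + k i) := by
          refine integral_congr_ae (Filter.Eventually.of_forall fun y => ?_)
          simp only [htr, tsum_mul_left]
          change e y • F (toTorus y) = _
          rw [hF, smul_eq_mul, periodization]
      _ = ∫ y, H y := h3.unique hsum
      _ = ∫ x : Rn n, e x * φ x :=
          (PiLp.volume_preserving_toLp (Fin n)).integral_comp hemb fun x : Rn n => e x * φ x
      _ = 𝓕 φ (intVec m) := by
          rw [SchwartzMap.fourier_coe, Real.fourier_eq']
          refine integral_congr_ae (Filter.Eventually.of_forall fun x => ?_)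
          simp only [e, mFourier_toTorus, smul_eq_mul]
          congr 4
          simp [intVec, PiLp.inner_apply, dotProduct]
  have hsm : Summable (UnitAddTorus.mFourierCoeff F) := by
    have h := summable_periodization (𝓕 φ) 0
    simpa only [zero_add, ← hcoef] using h
  have h := UnitAddTorus.hasSum_mFourier_series_apply_of_summable hsm (toTorus y)
  simpa only [hF, hcoef, mFourier_toTorus, smul_eq_mul] using h

/-! ### Linear changes of variables -/

/-- The absolute value of the determinant of an invertible linear map. -/
noncomputable def absDet {n : ℕ} (M : Rn n ≃L[ℝ] Rn n) : ℝ :=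
  |LinearMap.det (M.toLinearEquiv : Rn n →ₗ[ℝ] Rn n)|

theorem absDet_pos {n : ℕ} (M : Rn n ≃L[ℝ] Rn n) : 0 < absDet M :=
  abs_pos.2 (LinearEquiv.isUnit_det' M.toLinearEquiv).ne_zero

theorem integral_comp_equiv {n : ℕ} {E : Type*} [NormedAddCommGroup E] [NormedSpace ℝ E]
    (M : Rn n ≃L[ℝ] Rn n) (F : Rn n → E) : ∫ x, F (M x) = (absDet M)⁻¹ • ∫ x, F x := by
  have hemb : MeasurableEmbedding M := M.toHomeomorph.measurableEmbedding
  have hmap := Measure.map_linearMap_addHaar_eq_smul_addHaar (volume : Measure (Rn n))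
    (LinearEquiv.isUnit_det' M.toLinearEquiv).ne_zero
  have h1 : Measure.map M (volume : Measure (Rn n)) =
      ENNReal.ofReal (absDet M)⁻¹ • volume := by
    rw [absDet, ← abs_inv]
    exact hmap
  rw [← hemb.integral_map, h1, integral_smul_measure,
    ENNReal.toReal_ofReal (inv_nonneg.2 (absDet_pos M).le)]

/-- The unitary normalization `φ ↦ |det M|^{1/2} φ ∘ M` of a linear change of variables. -/
noncomputable def dil {n : ℕ} (M : Rn n ≃L[ℝ] Rn n) : 𝓢(Rn n, ℂ) ≃ₗ[ℂ] 𝓢(Rn n, ℂ) :=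
  LinearEquiv.ofLinearMap
    (((√(absDet M) : ℂ) • compCLMOfContinuousLinearEquiv ℂ M).toLinearMap)
    (((√(absDet M) : ℂ)⁻¹ • compCLMOfContinuousLinearEquiv ℂ M.symm).toLinearMap)
    (by
      have h : (√(absDet M) : ℂ) ≠ 0 := by
        exact_mod_cast (Real.sqrt_pos.2 (absDet_pos M)).ne'
      ext φ x
      simp [h])
    (by
      have h : (√(absDet M) : ℂ) ≠ 0 := by
        exact_mod_cast (Real.sqrt_pos.2 (absDet_pos M)).ne'
      ext φ x
      simp [h])

theorem dil_apply {n : ℕ} (M : Rn n ≃L[ℝ] Rn n) (φ : 𝓢(Rn n, ℂ)) (x : Rn n) :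
    dil M φ x = √(absDet M) * φ (M x) := by
  simp [dil]

/-- The inverse of `dil M`, which is also its transpose, as a continuous operator. -/
noncomputable def dilInv {n : ℕ} (M : Rn n ≃L[ℝ] Rn n) : 𝓢(Rn n, ℂ) →L[ℂ] 𝓢(Rn n, ℂ) :=
  (√(absDet M) : ℂ)⁻¹ • compCLMOfContinuousLinearEquiv ℂ M.symm

theorem dilInv_apply {n : ℕ} (M : Rn n ≃L[ℝ] Rn n) (φ : 𝓢(Rn n, ℂ)) (x : Rn n) :
    dilInv M φ x = (√(absDet M) : ℂ)⁻¹ * φ (M.symm x) := by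
  simp [dilInv]

theorem norm_toLp_sq {n : ℕ} (φ : 𝓢(Rn n, ℂ)) :
    ‖φ.toLp 2 (volume : Measure (Rn n))‖ ^ 2 = ∫ x, ‖φ x‖ ^ 2 := by
  have h : (((‖φ.toLp 2 (volume : Measure (Rn n))‖ ^ 2 : ℝ)) : ℂ) =
      ((∫ x, ‖φ x‖ ^ 2 : ℝ) : ℂ) := by
    rw [← integral_complex_ofReal]
    push_cast
    refine (inner_self_eq_norm_sq_to_K (𝕜 := ℂ) (φ.toLp 2 (volume : Measure (Rn n)))).symm.trans ?_
    rw [inner_toL2_toL2_eq φ φ volume]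
    exact integral_congr_ae (Filter.Eventually.of_forall fun x => inner_self_eq_norm_sq_to_K (φ x))
  exact_mod_cast h

theorem norm_toLp_congr {n : ℕ} {φ ψ : 𝓢(Rn n, ℂ)} (h : ∫ x, ‖φ x‖ ^ 2 = ∫ x, ‖ψ x‖ ^ 2) :
    ‖φ.toLp 2 (volume : Measure (Rn n))‖ = ‖ψ.toLp 2 (volume : Measure (Rn n))‖ := by
  rw [← norm_toLp_sq, ← norm_toLp_sq] at h
  exact (pow_left_inj₀ (norm_nonneg _) (norm_nonneg _) two_ne_zero).1 h

theorem norm_dil {n : ℕ} (M : Rn n ≃L[ℝ] Rn n) (φ : 𝓢(Rn n, ℂ)) :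
    ‖(dil M φ).toLp 2 (volume : Measure (Rn n))‖ = ‖φ.toLp 2 (volume : Measure (Rn n))‖ := by
  refine norm_toLp_congr ?_
  have h0 := absDet_pos M
  have h : ∀ x, ‖dil M φ x‖ ^ 2 = absDet M * ‖φ (M x)‖ ^ 2 := by
    intro x
    rw [dil_apply, norm_mul, mul_pow, Complex.norm_real, Real.norm_of_nonneg (Real.sqrt_nonneg _),
      Real.sq_sqrt h0.le]
  simp only [h]
  rw [integral_const_mul, integral_comp_equiv M fun x => ‖φ x‖ ^ 2, smul_eq_mul,
    mul_inv_cancel_left₀ h0.ne']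

theorem integral_mul_dil {n : ℕ} (M : Rn n ≃L[ℝ] Rn n) (φ ψ : 𝓢(Rn n, ℂ)) :
    ∫ x, ψ x * dil M φ x = ∫ x, dilInv M ψ x * φ x := by
  have h0 := absDet_pos M
  have hs : (√(absDet M) : ℂ) ≠ 0 := by exact_mod_cast (Real.sqrt_pos.2 h0).ne'
  have hs2 : (√(absDet M) : ℂ) * √(absDet M) = absDet M := by
    rw [← Complex.ofReal_mul, Real.mul_self_sqrt h0.le]
  have h := integral_comp_equiv M fun x => dilInv M ψ x * φ x
  simp only [dilInv_apply, M.symm_apply_apply] at h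
  simp only [dil_apply, dilInv_apply]
  have h1 : ∀ x, ψ x * (√(absDet M) * φ (M x)) =
      (absDet M : ℂ) * ((√(absDet M) : ℂ)⁻¹ * ψ x * φ (M x)) := by
    intro x
    rw [← hs2]
    field_simp
  simp only [h1]
  rw [integral_const_mul, h, Complex.real_smul, Complex.ofReal_inv, mul_inv_cancel_left₀]
  exact_mod_cast h0.ne'

/-- The map `x ↦ x A` of `ℝⁿ`; the inverse of `A` is passed as the argument `A'`. -/
noncomputable def rowEquiv {n : ℕ} (A A' : Matrix (Fin n) (Fin n) ℝ) (h : A' * A = 1) :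
    Rn n ≃L[ℝ] Rn n :=
  LinearEquiv.toContinuousLinearEquiv
    { toFun := fun x => WithLp.toLp 2 (⇑x ᵥ* A)
      map_add' := fun x y => by ext i; simp [Matrix.add_vecMul]
      map_smul' := fun c x => by ext i; simp [Matrix.smul_vecMul]
      invFun := fun x => WithLp.toLp 2 (⇑x ᵥ* A')
      left_inv := fun x => by
        simp [Matrix.vecMul_vecMul, mul_eq_one_comm.1 h]
      right_inv := fun x => by
        simp [Matrix.vecMul_vecMul, h] }

theorem rowEquiv_apply {n : ℕ} {A A' : Matrix (Fin n) (Fin n) ℝ} (h : A' * A = 1) (x : Rn n) :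
    rowEquiv A A' h x = WithLp.toLp 2 (⇑x ᵥ* A) := rfl

theorem rowEquiv_symm_apply {n : ℕ} {A A' : Matrix (Fin n) (Fin n) ℝ} (h : A' * A = 1) (x : Rn n) :
    (rowEquiv A A' h).symm x = WithLp.toLp 2 (⇑x ᵥ* A') := rfl

open FourierTransform in
theorem fourier_comp_rowEquiv {n : ℕ} {A A' : Matrix (Fin n) (Fin n) ℝ} (h : A' * A = 1)
    (f : Rn n → ℂ) (ξ : Rn n) : 𝓕 (fun x => f (rowEquiv A A' h x)) ξ =
      (absDet (rowEquiv A A' h))⁻¹ • 𝓕 f (WithLp.toLp 2 (⇑ξ ᵥ* A'ᵀ)) := by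
  rw [Real.fourier_eq, Real.fourier_eq, ← integral_comp_equiv (rowEquiv A A' h)]
  refine integral_congr_ae (Filter.Eventually.of_forall fun x => ?_)
  have : inner ℝ (rowEquiv A A' h x) (WithLp.toLp 2 (⇑ξ ᵥ* A'ᵀ)) = inner ℝ x ξ := by
    have hin : ∀ x y : Rn n, inner ℝ x y = ⇑x ⬝ᵥ ⇑y := fun x y => by
      simp [PiLp.inner_apply, dotProduct, mul_comm]
    rw [hin, hin, rowEquiv_apply, Matrix.vecMul_transpose, Matrix.dotProduct_mulVec,
      Matrix.vecMul_vecMul, mul_eq_one_comm.1 h, Matrix.vecMul_one]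
  simp only [this]

/-! ### Matrices whose operators preserve the Poisson distributions -/

theorem ratToRealSp_one {n : ℕ} : ratToRealSp (1 : symplecticGroup (Fin n) ℚ) = 1 := by
  apply Subtype.ext
  simp [ratToRealSp]

theorem ratToRealSp_mul {n : ℕ} (g g' : symplecticGroup (Fin n) ℚ) :
    ratToRealSp (g * g') = ratToRealSp g * ratToRealSp g' := by
  apply Subtype.ext
  simp only [ratToRealSp, Submonoid.coe_mul, Matrix.map_mul]

/-- The set of rational symplectic matrices for which some operator of the Weil representation
extends to `𝓢'` and maps `𝒫` into itself; it is closed under multiplication. -/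
def poissonStabilizer (n : ℕ) : Submonoid (symplecticGroup (Fin n) ℚ) where
  carrier := {g | ∃ U W, IsWeilOperator (ratToRealSp g) U ∧ ExtendsToTempered U W ∧
    ∀ χ ∈ poissonSpace n, W χ ∈ poissonSpace n}
  mul_mem' := by
    rintro g g' ⟨U, W, hU, hW, hP⟩ ⟨U', W', hU', hW', hP'⟩
    refine ⟨U'.trans U, W.comp W', ?_, hW.mul hW', fun χ hχ => hP _ (hP' _ hχ)⟩
    rw [ratToRealSp_mul]
    exact hU.mul hU'
  one_mem' := ⟨LinearIsometryEquiv.refl ℂ _, ContinuousLinearMap.id ℂ _,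
    by rw [ratToRealSp_one]; exact IsWeilOperator.one, fun f => rfl, fun χ hχ => hχ⟩

/-- It suffices to give, on Schwartz functions, an operator of the Weil representation and its
transpose, provided that the transpose carries Poisson distributions to Poisson distributions. -/
theorem mem_poissonStabilizer {n : ℕ} {g : symplecticGroup (Fin n) ℚ}
    (B : 𝓢(Rn n, ℂ) ≃ₗ[ℂ] 𝓢(Rn n, ℂ)) (Bt : 𝓢(Rn n, ℂ) →L[ℂ] 𝓢(Rn n, ℂ))
    (hn : ∀ φ, ‖(B φ).toLp 2 (volume : Measure (Rn n))‖ = ‖φ.toLp 2 (volume : Measure (Rn n))‖)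
    (ht : ∀ φ ψ, ∫ x, ψ x * B φ x = ∫ x, Bt ψ x * φ x)
    (hc : ∀ h φ x, B (heisSchwartz (heisAut (ratToRealSp g) h) φ) x = heisFun h (B φ) x)
    (hP : ∀ (a : Matrix (Fin n) (Fin n) ℚ) (b : Fin n → ℚ) (χ : 𝓢'(Rn n, ℂ)), a.det ≠ 0 →
      (∀ φ : 𝓢(Rn n, ℂ), HasSum (fun k => φ (latticePoint a b k)) (χ φ)) →
      ∀ χ' : 𝓢'(Rn n, ℂ), (∀ φ, χ' φ = χ (Bt φ)) → χ' ∈ poissonSpace n) :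
    g ∈ poissonStabilizer n := by
  obtain ⟨U, hU, hW⟩ := exists_isWeilOperator_of_schwartz B Bt hn ht fun h φ => by
    ext x
    rw [hc, heisSchwartz_apply]
  refine ⟨U, _, hU, hW, fun χ hχ => map_mem_poissonSpace (fun a b χ ha hs => ?_) hχ⟩
  exact hP a b χ ha hs _ fun φ => rfl

/-! ### The matrices `(A 0; 0 A⁻ᵀ)` -/

theorem heisAut_spDiag {n : ℕ} {A A' : Matrix (Fin n) (Fin n) ℚ} (h : A' * A = 1)
    (x : RealHeis n) : heisAut (ratToRealSp (spDiag A A' h)) x =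
      ⟨x.vPlus ᵥ* A.map (fun q : ℚ => (q : ℝ)), x.vMinus ᵥ* (A'.map (fun q : ℚ => (q : ℝ)))ᵀ,
        x.alpha⟩ := by
  have : ((ratToRealSp (spDiag A A' h) : symplecticGroup (Fin n) ℝ) :
      Matrix (Fin n ⊕ Fin n) (Fin n ⊕ Fin n) ℝ) =
      fromBlocks (A.map (fun q : ℚ => (q : ℝ))) 0 0 (A'.map (fun q : ℚ => (q : ℝ)))ᵀ := by
    simp [ratToRealSp, spDiag, fromBlocks_map]
    rfl
  simp [heisAut, this, Matrix.vecMul_fromBlocks]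

theorem ratCast_mul_eq_one {n : ℕ} {A A' : Matrix (Fin n) (Fin n) ℚ} (h : A' * A = 1) :
    A'.map (fun q : ℚ => (q : ℝ)) * A.map (fun q : ℚ => (q : ℝ)) = 1 := by
  have := congrArg (fun M => M.map (Rat.castHom ℝ)) h
  rw [Matrix.map_mul, Matrix.map_one _ (map_zero _) (map_one _)] at this
  exact this

theorem ratPoint_vecMul {n : ℕ} (r : Fin n → ℚ) (A : Matrix (Fin n) (Fin n) ℚ) :
    WithLp.toLp 2 (⇑(ratPoint r) ᵥ* A.map (fun q : ℚ => (q : ℝ))) = ratPoint (r ᵥ* A) := by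
  ext i
  simp [ratPoint, Matrix.vecMul, dotProduct, Finset.mul_sum, mul_assoc]

theorem spDiag_mem_poissonStabilizer {n : ℕ} {A A' : Matrix (Fin n) (Fin n) ℚ} (h : A' * A = 1) :
    spDiag A A' h ∈ poissonStabilizer n := by
  have hR := ratCast_mul_eq_one h
  set M := rowEquiv (A.map fun q : ℚ => (q : ℝ)) (A'.map fun q : ℚ => (q : ℝ)) hR with hM
  refine mem_poissonStabilizer (dil M) (dilInv M) (norm_dil M) (integral_mul_dil M) ?_ ?_
  · intro x φ y
    rw [dil_apply, heisSchwartz_apply, heisAut_spDiag, heisFun, heisFun, dil_apply, mul_assoc]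
    congr 2
    · rw [hM, rowEquiv_apply, rowEquiv_apply]
      congr 1
      ext i
      simp [Matrix.add_vecMul, Matrix.smul_vecMul]
    · have hdot : ∀ v w : Fin n → ℝ, (v ᵥ* A.map fun q : ℚ => (q : ℝ)) ⬝ᵥ
          (w ᵥ* (A'.map fun q : ℚ => (q : ℝ))ᵀ) = v ⬝ᵥ w := by
        intro v w
        rw [Matrix.vecMul_transpose, Matrix.dotProduct_mulVec, Matrix.vecMul_vecMul,
          mul_eq_one_comm.1 hR, Matrix.vecMul_one]
      simp only [heisPhase, hM, rowEquiv_apply, hdot]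
  · intro a b χ ha hs χ' hχ'
    have hd : (a * A').det ≠ 0 := by
      rw [Matrix.det_mul]
      refine mul_ne_zero ha fun h0 => ?_
      have := congrArg Matrix.det h
      rw [Matrix.det_mul, h0, zero_mul, Matrix.det_one] at this
      exact zero_ne_one this
    have hc : (√(absDet M) : ℂ) ≠ 0 := by
      exact_mod_cast (Real.sqrt_pos.2 (absDet_pos M)).ne'
    have h1 : (√(absDet M) : ℂ) • χ' ∈ poissonSpace n := by
      refine mem_poissonSpace_of_hasSum hd (b := b ᵥ* A') fun φ => ?_
      have h2 := (hs (dilInv M φ)).mul_left (√(absDet M) : ℂ)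
      rw [← hχ'] at h2
      refine h2.congr_fun fun k => ?_
      rw [dilInv_apply, mul_inv_cancel_left₀ hc, hM, rowEquiv_symm_apply, latticePoint_eq,
        latticePoint_eq, ratPoint_vecMul, Matrix.add_vecMul, Matrix.vecMul_vecMul]
    rwa [Submodule.smul_mem_iff _ hc] at h1

/-! ### The matrices `(1 S; 0 1)` -/

theorem heisAut_spUpper {n : ℕ} {S : Matrix (Fin n) (Fin n) ℚ} (hS : S.IsSymm)
    (x : RealHeis n) : heisAut (ratToRealSp (spUpper S hS)) x =
      ⟨x.vPlus, x.vPlus ᵥ* S.map (fun q : ℚ => (q : ℝ)) + x.vMinus, x.alpha⟩ := by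
  have : ((ratToRealSp (spUpper S hS) : symplecticGroup (Fin n) ℝ) :
      Matrix (Fin n ⊕ Fin n) (Fin n ⊕ Fin n) ℝ) =
      fromBlocks 1 (S.map (fun q : ℚ => (q : ℝ))) 0 1 := by
    simp [ratToRealSp, spUpper, fromBlocks_map]
  simp only [heisAut, this, Matrix.vecMul_fromBlocks]
  simp
  rfl

/-- The quadratic form `x S xᵗ / 2`. -/
noncomputable def quadHalf {n : ℕ} (S : Matrix (Fin n) (Fin n) ℝ) (x : Rn n) : ℝ :=
  (⇑x ᵥ* S) ⬝ᵥ ⇑x / 2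

theorem hasTemperateGrowth_quadHalf {n : ℕ} (S : Matrix (Fin n) (Fin n) ℝ) :
    (quadHalf S).HasTemperateGrowth := by
  have hcoord : ∀ i, Function.HasTemperateGrowth fun x : Rn n => x i := fun i =>
    (EuclideanSpace.proj i : Rn n →L[ℝ] ℝ).hasTemperateGrowth
  have : quadHalf S = fun x : Rn n => ∑ i, (∑ j, x j * S j i) * x i * (1 / 2) := by
    funext x
    simp only [quadHalf, Matrix.vecMul, dotProduct]
    rw [← Finset.sum_mul]
    ring
  rw [this]
  refine Function.HasTemperateGrowth.sum fun i _ => ?_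
  exact ((Function.HasTemperateGrowth.sum fun j _ =>
    (hcoord j).mul (Function.HasTemperateGrowth.const _)).mul (hcoord i)).mul
    (Function.HasTemperateGrowth.const _)

/-- The chirp `exp (i x S xᵗ / 2)`. -/
noncomputable def chirp {n : ℕ} (S : Matrix (Fin n) (Fin n) ℝ) (x : Rn n) : ℂ :=
  Complex.exp ((quadHalf S x : ℂ) * Complex.I)

theorem hasTemperateGrowth_chirp {n : ℕ} (S : Matrix (Fin n) (Fin n) ℝ) :
    (chirp S).HasTemperateGrowth := (hasTemperateGrowth_quadHalf S).cexp_mul_I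

theorem chirp_mul_chirp_neg {n : ℕ} (S : Matrix (Fin n) (Fin n) ℝ) (x : Rn n) :
    chirp S x * chirp (-S) x = 1 := by
  rw [chirp, chirp, ← Complex.exp_add]
  simp [quadHalf, Matrix.vecMul_neg, neg_div]

/-- Multiplication by a chirp. -/
noncomputable def chirpEquiv {n : ℕ} (S : Matrix (Fin n) (Fin n) ℝ) :
    𝓢(Rn n, ℂ) ≃ₗ[ℂ] 𝓢(Rn n, ℂ) :=
  LinearEquiv.ofLinearMap (smulLeftCLM ℂ (chirp S)).toLinearMap
    (smulLeftCLM ℂ (chirp (-S))).toLinearMap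
    (by
      ext φ x
      simp only [LinearMap.comp_apply, ContinuousLinearMap.coe_coe, LinearMap.id_apply,
        smulLeftCLM_apply_apply (hasTemperateGrowth_chirp _), smul_eq_mul]
      rw [← mul_assoc, chirp_mul_chirp_neg, one_mul])
    (by
      ext φ x
      simp only [LinearMap.comp_apply, ContinuousLinearMap.coe_coe, LinearMap.id_apply,
        smulLeftCLM_apply_apply (hasTemperateGrowth_chirp _), smul_eq_mul]
      rw [← mul_assoc, mul_comm (chirp (-S) x), chirp_mul_chirp_neg, one_mul])

theorem chirpEquiv_apply {n : ℕ} (S : Matrix (Fin n) (Fin n) ℝ) (φ : 𝓢(Rn n, ℂ)) (x : Rn n) :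
    chirpEquiv S φ x = chirp S x * φ x :=
  smulLeftCLM_apply_apply (hasTemperateGrowth_chirp S) φ x

theorem spUpper_mem_poissonStabilizer {n : ℕ} {S : Matrix (Fin n) (Fin n) ℚ} (hS : S.IsSymm) :
    spUpper S hS ∈ poissonStabilizer n := by
  set T := S.map fun q : ℚ => (q : ℝ) with hT
  have hTs : Tᵀ = T := by rw [hT, ← Matrix.transpose_map, hS.eq]
  have hsymm : ∀ v w : Fin n → ℝ, (v ᵥ* T) ⬝ᵥ w = (w ᵥ* T) ⬝ᵥ v := by
    intro v w
    rw [← Matrix.dotProduct_mulVec, dotProduct_comm, ← Matrix.vecMul_transpose, hTs]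
  refine mem_poissonStabilizer (chirpEquiv T) (smulLeftCLM ℂ (chirp T)) (fun φ => ?_)
    (fun φ ψ => ?_) ?_ ?_
  · refine norm_toLp_congr ?_
    simp only [chirpEquiv_apply, norm_mul, chirp, Complex.norm_exp_ofReal_mul_I, one_mul]
  · refine integral_congr_ae (Filter.Eventually.of_forall fun x => ?_)
    simp only [chirpEquiv_apply, smulLeftCLM_apply_apply (hasTemperateGrowth_chirp T), smul_eq_mul]
    ring
  · intro x φ y
    rw [chirpEquiv_apply, heisSchwartz_apply, heisAut_spUpper, heisFun, heisFun, chirpEquiv_apply,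
      ← hT]
    rw [mul_comm (chirp T _) (φ _), mul_assoc, mul_left_comm]
    congr 1
    rw [chirp, chirp, heisPhase, heisPhase, ← Complex.exp_add, ← Complex.exp_add, ← add_mul,
      ← add_mul, ← Complex.ofReal_add, ← Complex.ofReal_add]
    congr 3
    have hs : √(2 * Real.pi) * √(2 * Real.pi) = 2 * Real.pi := Real.mul_self_sqrt (by positivity)
    simp only [quadHalf, WithLp.ofLp_add, WithLp.ofLp_smul,
      Matrix.add_vecMul, Matrix.smul_vecMul, add_dotProduct, dotProduct_add, smul_dotProduct,
      dotProduct_smul, smul_eq_mul]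
    have h1 := hsymm ⇑y x.vPlus
    have h2 := dotProduct_comm ⇑y (x.vPlus ᵥ* T)
    have h3 := dotProduct_comm x.vPlus (x.vPlus ᵥ* T)
    rw [h1, h2, h3]
    linear_combination (-((x.vPlus ᵥ* T) ⬝ᵥ x.vPlus) / 2) * hs
  · intro a b χ ha hs χ' hχ'
    refine mem_poissonSpace_of_ratQuad ha (b := b) (a * S * aᵀ) ((2 : ℚ) • (b ᵥ* (S * aᵀ)))
      ((b ᵥ* S) ⬝ᵥ b) fun φ => ?_
    rw [hχ']
    refine (hs _).congr_fun fun k => ?_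
    rw [smulLeftCLM_apply_apply (hasTemperateGrowth_chirp T), smul_eq_mul, chirp]
    congr 4
    set kq : Fin n → ℚ := fun i => (k i : ℚ) with hkq
    have hr : ∀ r : Fin n → ℚ, quadHalf T (ratPoint r) = Real.pi * (((r ᵥ* S) ⬝ᵥ r : ℚ) : ℝ) := by
      intro r
      have h2 : √(2 * Real.pi) * √(2 * Real.pi) = 2 * Real.pi := Real.mul_self_sqrt (by positivity)
      have h3 : (((r ᵥ* S) ⬝ᵥ r : ℚ) : ℝ) =
          ((fun i => (r i : ℝ)) ᵥ* T) ⬝ᵥ fun i => (r i : ℝ) := by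
        simp [Matrix.vecMul, dotProduct, hT]
      simp only [quadHalf, ratPoint, WithLp.ofLp_smul, Matrix.smul_vecMul, smul_dotProduct,
        dotProduct_smul, smul_eq_mul, h3]
      linear_combination ((((fun i => (r i : ℝ)) ᵥ* T) ⬝ᵥ fun i => (r i : ℝ)) / 2) * h2
    have hsq : ∀ v w : Fin n → ℚ, (v ᵥ* S) ⬝ᵥ w = (w ᵥ* S) ⬝ᵥ v := by
      intro v w
      rw [← Matrix.dotProduct_mulVec, dotProduct_comm, ← Matrix.vecMul_transpose, hS.eq]
    rw [latticePoint_eq, hr, ratQuad, ← hkq]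
    congr 2
    have e1 : (kq ᵥ* (a * S * aᵀ)) ⬝ᵥ kq = ((kq ᵥ* a) ᵥ* S) ⬝ᵥ (kq ᵥ* a) := by
      rw [← Matrix.vecMul_vecMul, ← Matrix.vecMul_vecMul, Matrix.vecMul_transpose,
        dotProduct_comm, Matrix.dotProduct_mulVec, dotProduct_comm]
    have e2 : kq ⬝ᵥ ((2 : ℚ) • (b ᵥ* (S * aᵀ))) = 2 * ((b ᵥ* S) ⬝ᵥ (kq ᵥ* a)) := by
      rw [dotProduct_smul, smul_eq_mul, ← Matrix.vecMul_vecMul, Matrix.vecMul_transpose,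
        Matrix.dotProduct_mulVec, dotProduct_comm]
    rw [e1, e2, Matrix.add_vecMul, add_dotProduct, dotProduct_add, dotProduct_add,
      hsq (kq ᵥ* a) b]
    ring

/-! ### The matrix `J` and the Fourier transform -/

theorem heisAut_symJ {n : ℕ} (x : RealHeis n) :
    heisAut (ratToRealSp (SymplecticGroup.symJ (Fin n) ℚ)) x = ⟨x.vMinus, -x.vPlus, x.alpha⟩ := by
  have : ((ratToRealSp (SymplecticGroup.symJ (Fin n) ℚ) : symplecticGroup (Fin n) ℝ) :
      Matrix (Fin n ⊕ Fin n) (Fin n ⊕ Fin n) ℝ) = fromBlocks 0 (-1) 1 0 :=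
    Matrix.map_J (Fin n) (Rat.castHom ℝ)
  simp only [heisAut, this, Matrix.vecMul_fromBlocks]
  simp [Matrix.vecMul_neg]
  rfl

/-- The homothety `x ↦ x / (2π)`. -/
noncomputable def scaleInv (n : ℕ) : Rn n ≃L[ℝ] Rn n :=
  rowEquiv ((2 * Real.pi)⁻¹ • 1) ((2 * Real.pi) • 1) (by
    have : (2 * Real.pi) ≠ 0 := by positivity
    rw [Matrix.smul_mul, Matrix.mul_smul, smul_smul, mul_inv_cancel₀ this, one_smul,
      Matrix.mul_one])

theorem scaleInv_apply {n : ℕ} (x : Rn n) : scaleInv n x = (2 * Real.pi)⁻¹ • x := by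
  rw [scaleInv, rowEquiv_apply, Matrix.vecMul_smul, Matrix.vecMul_one]
  rfl

theorem scaleInv_symm_apply {n : ℕ} (x : Rn n) :
    (scaleInv n).symm x = (2 * Real.pi) • x := by
  rw [scaleInv, rowEquiv_symm_apply, Matrix.vecMul_smul, Matrix.vecMul_one]
  rfl

open FourierTransform in
/-- The symmetrically normalized Fourier transform
`φ ↦ (2π)^{-n/2} ∫ exp (-i x yᵗ) φ(y) dy`. -/
noncomputable def symFourier (n : ℕ) : 𝓢(Rn n, ℂ) ≃ₗ[ℂ] 𝓢(Rn n, ℂ) :=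
  (FourierTransform.fourierEquiv ℂ 𝓢(Rn n, ℂ)).trans (dil (scaleInv n))

open FourierTransform in
theorem symFourier_apply {n : ℕ} (φ : 𝓢(Rn n, ℂ)) (x : Rn n) :
    symFourier n φ x = √(absDet (scaleInv n)) *
      ∫ y : Rn n, Complex.exp (((-(⇑y ⬝ᵥ ⇑x) : ℝ) : ℂ) * Complex.I) * φ y := by
  have h : symFourier n φ x = dil (scaleInv n) (𝓕 φ) x := rfl
  rw [h, dil_apply, SchwartzMap.fourier_coe, Real.fourier_eq']
  congr 1
  refine integral_congr_ae (Filter.Eventually.of_forall fun y => ?_)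
  have hin : inner ℝ y (scaleInv n x) = (2 * Real.pi)⁻¹ * (⇑y ⬝ᵥ ⇑x) := by
    rw [scaleInv_apply, inner_smul_right]
    simp [PiLp.inner_apply, dotProduct, mul_comm]
  have hpi : (2 * Real.pi) ≠ 0 := by positivity
  simp only [hin, smul_eq_mul]
  congr 4
  field_simp

open FourierTransform in
/-- The lattice form of Poisson summation needed for `𝒫`: for an invertible real matrix `A` with
inverse `A'`, it relates the values of `𝓕 ψ` on a coset of the lattice `ℤⁿ A` to the values of `ψ`
on the dual lattice `ℤⁿ A'ᵀ`. -/
theorem SchwartzMap.hasSum_poisson_lattice {n : ℕ} {A A' : Matrix (Fin n) (Fin n) ℝ}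
    (h : A' * A = 1) (ψ : 𝓢(Rn n, ℂ)) (z : Fin n → ℝ) :
    HasSum (fun m : Fin n → ℤ => (absDet (rowEquiv A A' h) : ℂ)⁻¹ *
      ψ (-(WithLp.toLp 2 (⇑(intVec m) ᵥ* A'ᵀ))) *
      Complex.exp (((2 * Real.pi * ((fun i => (m i : ℝ)) ⬝ᵥ z) : ℝ) : ℂ) * Complex.I))
      (∑' k : Fin n → ℤ, 𝓕 ψ (rowEquiv A A' h (WithLp.toLp 2 z + intVec k))) := by
  let Φ : 𝓢(Rn n, ℂ) := compCLMOfContinuousLinearEquiv ℂ (rowEquiv A A' h) (𝓕 ψ)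
  have h1 := Φ.hasSum_poisson z
  have h2 : ∀ m, 𝓕 Φ (intVec m) = (absDet (rowEquiv A A' h) : ℂ)⁻¹ *
      ψ (-(WithLp.toLp 2 (⇑(intVec m) ᵥ* A'ᵀ))) := by
    intro m
    have h3 : 𝓕 Φ (intVec m) = 𝓕 (fun x => (𝓕 ψ : 𝓢(Rn n, ℂ)) (rowEquiv A A' h x)) (intVec m) := rfl
    rw [h3, fourier_comp_rowEquiv, Complex.real_smul, Complex.ofReal_inv]
    congr 1
    have h4 : (𝓕⁻ (𝓕 ψ : 𝓢(Rn n, ℂ)) : 𝓢(Rn n, ℂ)) = ψ := fourierInv_fourier_eq ψ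
    conv_rhs => rw [← h4]
    rw [SchwartzMap.fourierInv_coe, Real.fourierInv_eq_fourier_neg, neg_neg]
  simp only [h2] at h1
  exact h1

open FourierTransform in
theorem symJ_mem_poissonStabilizer (n : ℕ) :
    SymplecticGroup.symJ (Fin n) ℚ ∈ poissonStabilizer n := by
  set c : ℂ := Complex.ofReal √(absDet (scaleInv n)) with hc
  have hc0 : c ≠ 0 := by
    rw [hc]
    exact_mod_cast (Real.sqrt_pos.2 (absDet_pos (scaleInv n))).ne'
  have h2π : √(2 * Real.pi) * √(2 * Real.pi) = 2 * Real.pi := Real.mul_self_sqrt (by positivity)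
  have hs0 : √(2 * Real.pi) ≠ 0 := by positivity
  refine mem_poissonStabilizer (symFourier n)
    ((fourierCLM ℂ 𝓢(Rn n, ℂ)).comp (dilInv (scaleInv n))) (fun φ => ?_) (fun φ ψ => ?_) ?_ ?_
  · exact (norm_dil _ _).trans (norm_fourier_toL2_eq φ)
  · refine (integral_mul_dil (scaleInv n) (𝓕 φ) ψ).trans ?_
    exact (integral_fourier_mul_eq (dilInv (scaleInv n) ψ) φ).symm
  · intro h φ x
    rw [symFourier_apply, heisAut_symJ, heisFun, symFourier_apply, mul_assoc, ← hc]
    congr 1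
    rw [mul_comm, ← integral_const_mul]
    -- the substitution `y ↦ y - √(2π) v₋`
    rw [← integral_sub_right_eq_self _ (√(2 * Real.pi) • (WithLp.toLp 2 h.vMinus : Rn n))]
    refine integral_congr_ae (Filter.Eventually.of_forall fun y => ?_)
    simp only
    rw [heisSchwartz_apply, heisFun, sub_add_cancel]
    refine (show ∀ a b c d e : ℂ, a * b = c * d → a * (e * b) = c * (d * e) from
      fun a b c d e H => by linear_combination e * H) _ _ _ _ _ ?_
    rw [heisPhase, heisPhase, ← Complex.exp_add, ← Complex.exp_add, ← add_mul, ← add_mul,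
      ← Complex.ofReal_add, ← Complex.ofReal_add]
    congr 3
    simp only [WithLp.ofLp_add, WithLp.ofLp_sub, WithLp.ofLp_smul, dotProduct_add,
      sub_dotProduct, smul_dotProduct, dotProduct_smul, dotProduct_neg, smul_eq_mul]
    rw [dotProduct_comm h.vMinus ⇑x, dotProduct_comm h.vMinus h.vPlus]
    linear_combination (h.vPlus ⬝ᵥ h.vMinus) * h2π
  · intro a b χ ha hs χ' hχ'
    have hu : IsUnit a.det := ha.isUnit
    have hR : a⁻¹.map (fun q : ℚ => (q : ℝ)) * a.map (fun q : ℚ => (q : ℝ)) = 1 :=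
      ratCast_mul_eq_one (Matrix.nonsing_inv_mul a hu)
    set s := √(2 * Real.pi) with hsdef
    set A := s • a.map (fun q : ℚ => (q : ℝ)) with hA
    set A' := s⁻¹ • a⁻¹.map (fun q : ℚ => (q : ℝ)) with hA'
    have hAA : A' * A = 1 := by
      rw [hA, hA', Matrix.smul_mul, Matrix.mul_smul, hR, smul_smul, inv_mul_cancel₀ hs0, one_smul]
    set d : ℂ := Complex.ofReal (absDet (rowEquiv A A' hAA)) with hd
    have hd0 : d ≠ 0 := by
      rw [hd]; exact_mod_cast (absDet_pos _).ne'
    set z : Fin n → ℚ := b ᵥ* a⁻¹ with hz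
    have hdet : (-(a⁻¹)ᵀ).det ≠ 0 := by
      rw [Matrix.det_neg, Matrix.det_transpose]
      refine mul_ne_zero (pow_ne_zero _ (by norm_num)) ?_
      exact ((Matrix.isUnit_nonsing_inv_det_iff).2 hu).ne_zero
    have hcd : d * c ≠ 0 := mul_ne_zero hd0 hc0
    have hmem : (d * c) • χ' ∈ poissonSpace n := by
      refine mem_poissonSpace_of_ratQuad hdet (b := 0) 0 ((2 : ℚ) • z) 0 fun φ => ?_
      set ψ := dilInv (scaleInv n) φ with hψ
      have hp := (hasSum_poisson_lattice hAA ψ fun i => (z i : ℝ)).mul_left (d * c)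
      have hpt : ∀ k, rowEquiv A A' hAA (WithLp.toLp 2 (fun i => (z i : ℝ)) + intVec k) =
          latticePoint a b k := by
        intro k
        have h1 : b + (fun i => (k i : ℚ)) ᵥ* a = (z + fun i => (k i : ℚ)) ᵥ* a := by
          rw [Matrix.add_vecMul, hz, Matrix.vecMul_vecMul, Matrix.nonsing_inv_mul a hu,
            Matrix.vecMul_one]
        have h2 : s • (WithLp.toLp 2 (fun i => (z i : ℝ)) + intVec k : Rn n) =
            ratPoint (z + fun i => (k i : ℚ)) := by
          ext i; simp [ratPoint, intVec, hsdef, mul_add]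
        rw [latticePoint_eq, h1, ← ratPoint_vecMul, ← h2, rowEquiv_apply, hA, Matrix.vecMul_smul,
          WithLp.ofLp_smul, Matrix.smul_vecMul]
      have hval : χ' φ = ∑' k : Fin n → ℤ, 𝓕 ψ (rowEquiv A A' hAA
          (WithLp.toLp 2 (fun i => (z i : ℝ)) + intVec k)) := by
        rw [hχ']
        simp only [hpt]
        exact (hs _).tsum_eq.symm
      rw [← hval] at hp
      refine hp.congr_fun fun m => ?_
      have hpt' : (scaleInv n).symm (-(WithLp.toLp 2 (⇑(intVec m) ᵥ* A'ᵀ))) =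
          latticePoint (-(a⁻¹)ᵀ) 0 m := by
        rw [scaleInv_symm_apply, latticePoint_eq, hA', ← h2π, Matrix.transpose_smul,
          Matrix.vecMul_smul, zero_add, Matrix.vecMul_neg, mul_smul, ratPoint]
        congr 1
        ext i
        simp only [PiLp.smul_apply, PiLp.neg_apply, smul_eq_mul, Pi.smul_apply, Pi.neg_apply]
        rw [mul_neg, mul_inv_cancel_left₀ hs0]
        simp [Matrix.vecMul, dotProduct, intVec]
      have hph : ((Real.pi * ratQuad 0 ((2 : ℚ) • z) 0 m : ℝ) : ℂ) =
          ((2 * Real.pi * ((fun i => (m i : ℝ)) ⬝ᵥ fun i => (z i : ℝ)) : ℝ) : ℂ) := by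
        congr 1
        rw [ratQuad, Matrix.vecMul_zero, zero_dotProduct, dotProduct_smul, smul_eq_mul, zero_add,
          add_zero]
        simp only [dotProduct]
        push_cast
        ring
      rw [hph, hψ, dilInv_apply, hpt', ← hc, ← hd]
      field_simp
    rwa [Submodule.smul_mem_iff _ hcd] at hmem

/-! ### Invariance of the space of Poisson distributions -/

theorem poissonStabilizer_eq_top (n : ℕ) : poissonStabilizer n = ⊤ :=
  symplecticGroup_submonoid_eq_top _ (symJ_mem_poissonStabilizer n)
    (fun _ hS => spUpper_mem_poissonStabilizer hS) (fun _ _ h => spDiag_mem_poissonStabilizer h)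

theorem theorem3p2 (n : ℕ) (g : Matrix.symplecticGroup (Fin n) ℚ) :
    (∃ U : L2Rn n ≃ₗᵢ[ℂ] L2Rn n, IsWeilOperator (ratToRealSp g) U) ∧
    ∀ U : L2Rn n ≃ₗᵢ[ℂ] L2Rn n, IsWeilOperator (ratToRealSp g) U →
      ∃ W : 𝓢'(Rn n, ℂ) →L[ℂ] 𝓢'(Rn n, ℂ),
        ExtendsToTempered U W ∧
        (∀ W' : 𝓢'(Rn n, ℂ) →L[ℂ] 𝓢'(Rn n, ℂ), ExtendsToTempered U W' → W' = W) ∧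
        (poissonSpace n).map (W : 𝓢'(Rn n, ℂ) →ₗ[ℂ] 𝓢'(Rn n, ℂ)) = poissonSpace n := by
  obtain ⟨U₀, W₀, hU₀, hW₀, hP₀⟩ : g ∈ poissonStabilizer n :=
    (poissonStabilizer_eq_top n).symm ▸ Submonoid.mem_top g
  obtain ⟨U₁, W₁, hU₁, hW₁, hP₁⟩ : g⁻¹ ∈ poissonStabilizer n :=
    (poissonStabilizer_eq_top n).symm ▸ Submonoid.mem_top g⁻¹
  refine ⟨⟨U₀, hU₀⟩, fun U hU => ?_⟩
  obtain ⟨c, hc, hcU⟩ := hU₀.exists_smul hU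
  refine ⟨c • W₀, hW₀.of_smul hcU, fun W' hW' => (hW₀.of_smul hcU).unique hW', ?_⟩
  have hP : ∀ χ ∈ poissonSpace n, (c • W₀) χ ∈ poissonSpace n := fun χ hχ =>
    Submodule.smul_mem _ c (hP₀ χ hχ)
  refine le_antisymm (Submodule.map_le_iff_le_comap.2 hP) fun χ hχ => ?_
  -- the product of the operators for `g` and `g⁻¹` is a nonzero scalar
  have hone : IsWeilOperator (1 : symplecticGroup (Fin n) ℝ) (U₁.trans U) := by
    rw [← ratToRealSp_one, ← mul_inv_cancel g, ratToRealSp_mul]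
    exact hU.mul hU₁
  obtain ⟨e, he, heU⟩ := exists_smul_of_isWeilOperator_one hone
  have hid : ExtendsToTempered (U₁.trans U) (e • ContinuousLinearMap.id ℂ 𝓢'(Rn n, ℂ)) :=
    ExtendsToTempered.of_smul (U := LinearIsometryEquiv.refl ℂ _) (fun f => rfl) heU
  have hprod := hid.unique ((hW₀.of_smul hcU).mul hW₁)
  refine ⟨e⁻¹ • W₁ χ, Submodule.smul_mem _ _ (hP₁ χ hχ), ?_⟩
  have h1 : (c • W₀) (W₁ χ) = e • χ :=
    congrArg (fun W : 𝓢'(Rn n, ℂ) →L[ℂ] 𝓢'(Rn n, ℂ) => W χ) hprod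
  rw [ContinuousLinearMap.coe_coe, map_smul, h1, smul_smul, inv_mul_cancel₀ he, one_smul]
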